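/- **Electrical networks.** An electrical network $\mathcal E(G,w)$ is a finite planar graph $G$ (loops and multiple edges allowed) embedded in a closed disk, with a set of $n\ge 1$ boundary nodes that lie on the boundary circle and are numbered clockwise $1,\dots,n$, all other nodes (inner nodes) lying inside the disk, together with a conductivity function $w:E(G)\to\mathbb R_{>0}$. It is *connected* if $G$ is connected. Its median graph has the midpoints of the edges of $G$ as inner vertices; each corner of $G$ (a pair of consecutive edges around a node, where at a boundary node the boundary circle separates the last edge from the first one) gives a median edge joining the two midpoints, and in the corners next to the boundary circle the median edge runs from the midpoint to the boundary circle. A *strand* is a maximal path that goes straight through every (four-valent) midpoint. The network is *minimal* if no strand intersects itself, no strand is a closed loop, and any two different strands have at most one midpoint in common. **Lam models.** A Lam model $N(\Gamma,\omega)$ is a finite planar bipartite (black/white) graph $\Gamma$ embedded in a disk, whose boundary nodes lie on the boundary circle, are numbered clockwise and have degree one, with positive edge weights $\omega$. Its oriented median graph $\Gamma_M$ has as nodes the boundary nodes of $\Gamma$ and the midpoints of the edges of $\Gamma$ that connect inner nodes; each corner at an inner node of $\Gamma$ gives an edge between the median nodes on the two edges of the corner, oriented clockwise around white inner nodes and counterclockwise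 around black inner nodes. The strands of $\Gamma_M$ are the maximal oriented paths that go straight through every midpoint. The Lam model is *minimal* if 1. no strand passes through a midpoint twice; 2. no strand is a closed loop, and a strand that starts and ends at the same boundary node does so only at a boundary node that is isolated in $\Gamma_M$ (joined to no other node of $\Gamma_M$); 3. there is no oriented lens: there are no two different strands and two different nodes $p\ne q$ of $\Gamma_M$ such that both strands run, in the sense of their orientation, from $p$ to $q$. **The generalized Temperley trick.** Let $\mathcal E(G,w)$ be an electrical network with $n$ boundary nodes. The Lam model $N(\mathcal E^T,\boldsymbol\omega)$ has $2n$ white boundary nodes: node $2i-1$ sits at the boundary node $i$ of $G$, and node $2i$ lies on the boundary arc between the boundary nodes $i$ and $i+1$ (cyclically). Its inner nodes are a black node $b_v$ for each node $v$ of $G$, inner or boundary; a black node $b_F$ for each face $F$ of $G$ in the disk; and a white node $w_e$ at the midpoint of each edge $e$ of $G$. Its edges are: for each end $v$ of an edge $e$, an edge $b_vw_e$ of weight $w(e)$; for each side of an edge $e$, an edge of weight $1$ from $w_e$ to $b_F$, where $F$ is the face on that side; for each $i$, an edge of weight $1$ from $b_i$ to the boundary node $2i-1$; and for each $i$, an edge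 of weight $1$ from the boundary node $2i$ to $b_F$, where $F$ is the face that contains the boundary arc between $i$ and $i+1$. **Theorem.** If an electrical network $\mathcal E$ is minimal and connected, then the Lam model $N(\mathcal E^T,\boldsymbol\omega)$ is minimal. -/

import Mathlib

universe u

/-- Combinatorial data of a finite graph (loops and multiple edges allowed) drawn in a closed disk with
`n` boundary nodes, numbered clockwise along the boundary circle (from `0` to `n - 1` here).

* `Dart` is the set of oriented edges. A dart `d` starts at its tail; `flip d` is the same edge
  traversed backwards.
* `Sum.inr i` is the ray that points out of the disk at the `i`-th boundary node.
* `rot` sends each dart or ray to the next one in counterclockwise order around its tail. Thus the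
  nodes are the cycles of `rot`, and the boundary nodes are the cycles which contain a ray. -/
structure RotationGraph (n : ℕ) where
  Dart : Type u
  finite_dart : Finite Dart
  flip : Equiv.Perm Dart
  flip_flip : ∀ d, flip (flip d) = d
  flip_ne : ∀ d, flip d ≠ d
  rot : Equiv.Perm (Dart ⊕ Fin n)
  ray_injective : ∀ i j : Fin n, rot.SameCycle (Sum.inr i) (Sum.inr j) → i = j

namespace RotationGraph

variable {n : ℕ} (G : RotationGraph.{u} n)

/-- Nodes: cycles of the counterclockwise rotation. -/
def Node : Type u := Quotient (Equiv.Perm.SameCycle.setoid G.rot)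

/-- The node at which a dart or a ray starts. -/
def node (x : G.Dart ⊕ Fin n) : G.Node := Quotient.mk _ x

/-- The `i`-th boundary node. -/
def boundaryNode (i : Fin n) : G.Node := G.node (Sum.inr i)

/-- Inner nodes are the nodes that are not boundary nodes. -/
def IsInner (v : G.Node) : Prop := ∀ i, v ≠ G.boundaryNode i

/-- Edges: pairs `{d, flip d}`. -/
def Edge : Type u := Quotient (Equiv.Perm.SameCycle.setoid G.flip)

/-- The edge that carries a dart. -/
def edge (d : G.Dart) : G.Edge := Quotient.mk _ d

/-- The permutation that walks clockwise around the faces: a dart `d` has a face on its right-hand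
side, and the next dart along that face is `rot (flip d)`. The ray at a boundary node stands for the
boundary arc from this boundary node to the (clockwise) next one, and is followed by the dart or ray
that comes after the ray of that next boundary node. -/
def facePerm : Equiv.Perm (G.Dart ⊕ Fin n) :=
  (Equiv.sumCongr G.flip (finRotate n)).trans G.rot

/-- Faces of the graph in the disk, including those that touch the boundary circle. -/
def Face : Type u := Quotient (Equiv.Perm.SameCycle.setoid G.facePerm)

/-- The face on the right of a dart; for the ray of the `i`-th boundary node, the face that contains
the boundary arc between the `i`-th boundary node and the next one. -/
def face (x : G.Dart ⊕ Fin n) : G.Face := Quotient.mk _ x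

/-- The underlying simple graph on the nodes, used for connectivity only. -/
def graph : SimpleGraph G.Node :=
  SimpleGraph.fromRel fun u v =>
    ∃ d, G.node (Sum.inl d) = u ∧ G.node (Sum.inl (G.flip d)) = v

end RotationGraph

/-- A graph embedded into a disk, with `n` boundary nodes on the boundary circle, given up to
homeomorphism by its combinatorial map. Every component of the graph contains a boundary node, that is,
the graph together with the boundary circle is connected. Planarity is Euler's formula for the graph
together with the boundary circle: its nodes are the nodes of the graph, it has `n` additional edges
(the arcs of the circle) and one additional face (the outside), so
`#nodes - (#edges + n) + (#faces + 1) = 2`. -/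
structure DiskGraph (n : ℕ) extends RotationGraph.{u} n where
  reaches_boundary : ∀ v, ∃ i, toRotationGraph.graph.Reachable v (toRotationGraph.boundaryNode i)
  euler : (Nat.card toRotationGraph.Node : ℤ) - Nat.card toRotationGraph.Edge
    + Nat.card toRotationGraph.Face = n + 1

/-- An electrical network with `n` boundary nodes: a graph embedded into a disk, with a positive
conductivity on every edge. -/
structure ElectricalNetwork (n : ℕ) extends DiskGraph.{u} n where
  conductivity : toRotationGraph.Edge → ℝ
  conductivity_pos : ∀ e, 0 < conductivity e

namespace ElectricalNetwork

variable {n : ℕ} (E : ElectricalNetwork.{u} n)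

/-- The network is connected if its graph is. -/
def Connected : Prop := E.graph.Connected

/-- The edges of the median graph are the corners of the network: the element `c` stands for the
corner between `c` and `rot c`, which are consecutive in counterclockwise order around a node. The
median edge in this corner joins the midpoints of the edges carried by `c` and `rot c`; it runs
to the boundary circle, next to the boundary node, at an end where `c` or `rot c` is a ray. -/
abbrev MedianEdge : Type u := E.Dart ⊕ Fin n

/-- Two median edges follow each other straight through the midpoint of an edge. Among the four
median edges at the midpoint of the edge of `d`, the corner on the left of `d` at its tail (between
`d` and `rot d`) is opposite to the corner between `flip d` and `rot (flip d)`, and the corner on the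
right of `d` at its tail (the one whose second side is `d`) is opposite to the corner whose second side
is `flip d`. -/
def Opposite (c c' : E.MedianEdge) : Prop :=
  ∃ d : E.Dart, (c = Sum.inl d ∧ c' = Sum.inl (E.flip d)) ∨
    (E.rot c = Sum.inl d ∧ E.rot c' = Sum.inl (E.flip d))

/-- The strands of the median graph: classes of median edges under going straight through the
midpoints. -/
def Strand : Type u := Quot E.Opposite

/-- The strand that contains a median edge. -/
def strand (c : E.MedianEdge) : E.Strand := Quot.mk _ c

/-- The strand `s` passes through the midpoint of the edge `e`. -/
def PassesThrough (s : E.Strand) (e : E.Edge) : Prop :=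
  ∃ (c : E.MedianEdge) (d : E.Dart), E.strand c = s ∧ E.edge d = e ∧
    (c = Sum.inl d ∨ E.rot c = Sum.inl d)

/-- Minimal electrical networks. -/
structure IsMinimal : Prop where
  /-- The two straight lines through each midpoint belong to different strands. -/
  no_self_intersection : ∀ d : E.Dart,
    E.strand (Sum.inl d) ≠ E.strand (E.rot.symm (Sum.inl d))
  /-- Each strand has an end on the boundary circle. -/
  no_closed_strand : ∀ s : E.Strand, ∃ (c : E.MedianEdge) (i : Fin n),
    E.strand c = s ∧ (c = Sum.inr i ∨ E.rot c = Sum.inr i)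
  /-- Two different strands have at most one midpoint in common. -/
  no_lens : ∀ (s t : E.Strand) (e f : E.Edge), s ≠ t →
    E.PassesThrough s e → E.PassesThrough t e → E.PassesThrough s f → E.PassesThrough t f → e = f

end ElectricalNetwork

/-- The two colours of the nodes of a Lam model. -/
inductive NodeColor
  | black
  | white

/-- A Lam model with `n` boundary nodes: a bipartite graph embedded into a disk, whose boundary nodes
have degree one, with positive edge weights. -/
structure LamModel (n : ℕ) extends DiskGraph.{u} n where
  boundary_degree_one : ∀ i, ∃! d : Dart,
    toRotationGraph.node (Sum.inl d) = toRotationGraph.boundaryNode i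
  color : toRotationGraph.Node → NodeColor
  bipartite : ∀ d : Dart, color (toRotationGraph.node (Sum.inl d)) ≠
    color (toRotationGraph.node (Sum.inl (flip d)))
  weight : toRotationGraph.Edge → ℝ
  weight_pos : ∀ e, 0 < weight e

namespace LamModel

variable {n : ℕ} (L : LamModel.{u} n)

/-- Edges that connect inner nodes. -/
def InnerEdge : Type u := {e : L.Edge // ∀ d, L.edge d = e → L.IsInner (L.node (Sum.inl d))}

/-- Nodes of the oriented median graph: the boundary nodes of the Lam model and the midpoints of
the edges that connect inner nodes. -/
abbrev MedianNode : Type u := Fin n ⊕ L.InnerEdge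

/-- Edges of the oriented median graph: for each inner node `v` and each dart `a` that starts at `v`
there is one median edge, namely the corner of `v` that begins at the edge of `a` and goes
counterclockwise around `v` if `v` is black, and clockwise if `v` is white. -/
def MedianEdge : Type u := {d : L.Dart // L.IsInner (L.node (Sum.inl d))}

/-- The next dart around its tail, counterclockwise if the tail is black and clockwise if it is
white. -/
def turn (d : L.Dart) : L.Dart ⊕ Fin n :=
  match L.color (L.node (Sum.inl d)) with
  | NodeColor.black => L.rot (Sum.inl d)
  | NodeColor.white => L.rot.symm (Sum.inl d)

/-- The median node on the edge of a dart `d` that starts at an inner node: the boundary node to which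
`d` leads, or else the midpoint of the edge of `d`. -/
def LiesOn (d : L.Dart) : L.MedianNode → Prop
  | Sum.inl i => L.node (Sum.inl (L.flip d)) = L.boundaryNode i
  | Sum.inr e => L.edge d = e.1

/-- The median edge `a` starts at the median node `p`. -/
def Leaves (a : L.MedianEdge) (p : L.MedianNode) : Prop := L.LiesOn a.1 p

/-- The median edge `a` ends at the median node `p`. -/
def Enters (a : L.MedianEdge) (p : L.MedianNode) : Prop :=
  ∃ d : L.Dart, L.turn a.1 = Sum.inl d ∧ L.LiesOn d p

/-- The median edge `b` continues the median edge `a` straight through the midpoint at which `a`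
ends. -/
def Straight (a b : L.MedianEdge) : Prop :=
  ∃ d : L.Dart, L.turn a.1 = Sum.inl d ∧ b.1 = L.flip d

/-- The strands of the oriented median graph: classes of median edges under going straight. -/
def Strand : Type u := Quot L.Straight

/-- The strand that contains a median edge. -/
def strand (a : L.MedianEdge) : L.Strand := Quot.mk _ a

/-- The strand `s` runs, along its orientation, from the median node `p` to the median node `q`. -/
def Runs (s : L.Strand) (p q : L.MedianNode) : Prop :=
  ∃ a b : L.MedianEdge, L.strand a = s ∧ L.Leaves a p ∧
    Relation.ReflTransGen L.Straight a b ∧ L.Enters b q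

/-- The boundary node `i` is isolated in the median graph: no median edge joins it to another
median node. -/
def IsIsolated (i : Fin n) : Prop :=
  ∀ (a : L.MedianEdge) (p : L.MedianNode),
    (L.Leaves a (Sum.inl i) ∧ L.Enters a p) ∨ (L.Leaves a p ∧ L.Enters a (Sum.inl i)) →
      p = Sum.inl i

/-- Minimal Lam models. -/
structure IsMinimal : Prop where
  /-- A strand leaves each midpoint at most once. -/
  no_self_intersection : ∀ (a b : L.MedianEdge) (e : L.InnerEdge),
    L.Leaves a (Sum.inr e) → L.Leaves b (Sum.inr e) → L.strand a = L.strand b → a = b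
  /-- No strand is a closed loop: each strand starts at a boundary node. -/
  no_closed_strand : ∀ s : L.Strand, ∃ (a : L.MedianEdge) (i : Fin n),
    L.strand a = s ∧ L.Leaves a (Sum.inl i)
  /-- No strand is a loop attached to a boundary node, unless this boundary node is isolated. -/
  no_boundary_loop : ∀ (a b : L.MedianEdge) (i : Fin n), L.strand a = L.strand b →
    L.Leaves a (Sum.inl i) → L.Enters b (Sum.inl i) → L.IsIsolated i
  /-- No two different strands both run from one median node to another one. -/
  no_oriented_lens : ∀ (s t : L.Strand) (p q : L.MedianNode), s ≠ t → p ≠ q →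
    ¬ (L.Runs s p q ∧ L.Runs t p q)

end LamModel

/-- Darts of the graph of the generalized Temperley trick. For each dart or ray `x` of the network
there are two edges:

* the primal edge, with darts `blackV x` and `whiteV x`. It joins the black node of the network node
  at which `x` starts to the white node of the edge of `x` or, for the ray `x` of the `i`-th boundary
  node, to the `i`-th odd boundary node;
* the dual edge, with darts `blackF x` and `whiteF x`. It joins the black node of the face of `x` to
  the white node of the edge of `x` or, for the ray `x` of the `i`-th boundary node, to the `i`-th even
  boundary node. -/
inductive TemperleyDart (X : Type u) : Type u
  | blackV (x : X)
  | whiteV (x : X)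
  | blackF (x : X)
  | whiteF (x : X)

theorem RotationGraph.card_quotient_sameCycle {X Y : Type*} (σ : Equiv.Perm X) (f : X → Y)
    (hs : Function.Surjective f) (hf : ∀ x y, σ.SameCycle x y ↔ f x = f y) :
    Nat.card (Quotient (Equiv.Perm.SameCycle.setoid σ)) = Nat.card Y := by
  refine Nat.card_congr (Equiv.ofBijective (Quotient.lift f fun x y h => (hf x y).1 h) ⟨?_, ?_⟩)
  · rintro ⟨x⟩ ⟨y⟩ h
    exact Quotient.sound ((hf x y).2 h)
  · intro y
    obtain ⟨x, rfl⟩ := hs y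
    exact ⟨Quotient.mk _ x, rfl⟩

theorem RotationGraph.sameCycle_invariant {X Y : Type*} {σ : Equiv.Perm X} {f : X → Y}
    (hf : ∀ x, f (σ x) = f x) {x y : X} (h : σ.SameCycle x y) : f x = f y := by
  obtain ⟨k, rfl⟩ := h
  have key : ∀ (m : ℕ) (z : X), f ((σ ^ m) z) = f z := by
    intro m
    induction m with
    | zero => intro z; rfl
    | succ m ih => intro z; rw [pow_succ, Equiv.Perm.mul_apply, ih, hf]
  rcases k with m | m
  · simpa using (key m x).symm
  · have := key (m + 1) ((σ ^ (Int.negSucc m)) x)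
    rw [zpow_negSucc, ← Equiv.Perm.mul_apply, mul_inv_cancel, Equiv.Perm.one_apply] at this
    rw [zpow_negSucc]
    exact this

theorem RotationGraph.sameCycle_map {X Z : Type*} {σ : Equiv.Perm X} {τ : Equiv.Perm Z} {g : X → Z}
    (hg : ∀ x, τ.SameCycle (g x) (g (σ x))) {x y : X} (h : σ.SameCycle x y) :
    τ.SameCycle (g x) (g y) := by
  have : Quotient.mk (Equiv.Perm.SameCycle.setoid τ) (g x) =
      Quotient.mk (Equiv.Perm.SameCycle.setoid τ) (g y) :=
    RotationGraph.sameCycle_invariant (f := fun z => Quotient.mk (Equiv.Perm.SameCycle.setoid τ) (g z))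
      (fun z => (Quotient.sound (hg z)).symm) h
  exact Quotient.exact this

theorem RotationGraph.sameCycle_flip_iff {n : ℕ} (G : RotationGraph.{u} n) (d d' : G.Dart) :
    G.flip.SameCycle d d' ↔ d' = d ∨ d' = G.flip d := by
  constructor
  · intro h
    have := RotationGraph.sameCycle_invariant (σ := G.flip)
      (f := fun z => d' = z ∨ d' = G.flip z)
      (fun z => by simp only [G.flip_flip, eq_iff_iff]; tauto) h
    rw [this]; exact Or.inl rfl
  · rintro (rfl | rfl)
    · exact Equiv.Perm.SameCycle.refl _ _
    · exact ⟨1, by simp⟩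

theorem RotationGraph.card_dart {n : ℕ} (G : RotationGraph.{u} n) :
    Nat.card G.Dart = 2 * Nat.card G.Edge := by
  classical
  have := G.finite_dart
  have : Fintype G.Dart := Fintype.ofFinite _
  have hE : Finite G.Edge := Quotient.finite _
  have : Fintype G.Edge := Fintype.ofFinite _
  rw [Nat.card_eq_fintype_card, Nat.card_eq_fintype_card, ← Finset.card_univ, ← Finset.card_univ]
  rw [Finset.card_eq_sum_card_fiberwise (f := G.edge) (t := Finset.univ) (by simp)]
  rw [Finset.sum_const_nat (m := 2), mul_comm]
  rintro ⟨d⟩ -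
  rw [Finset.card_eq_two]
  refine ⟨d, G.flip d, (G.flip_ne d).symm, ?_⟩
  ext d'
  simp only [Finset.mem_filter, Finset.mem_univ, true_and, Finset.mem_insert, Finset.mem_singleton]
  rw [← G.sameCycle_flip_iff]
  constructor
  · intro h
    exact (Quotient.exact h).symm
  · intro h
    exact Quotient.sound h.symm

theorem RotationGraph.reachable_flip {n : ℕ} (G : RotationGraph.{u} n) (d : G.Dart) :
    G.graph.Reachable (G.node (Sum.inl d)) (G.node (Sum.inl (G.flip d))) := by
  by_cases h : G.node (Sum.inl d) = G.node (Sum.inl (G.flip d))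
  · rw [h]
  · exact SimpleGraph.Adj.reachable ((SimpleGraph.fromRel_adj _ _ _).2 ⟨h, Or.inl ⟨d, rfl, rfl⟩⟩)

theorem RotationGraph.node_eq_of_rot {n : ℕ} (G : RotationGraph.{u} n) {x y : G.Dart ⊕ Fin n}
    (h : G.rot x = y) : G.node x = G.node y :=
  Quotient.sound (show G.rot.SameCycle x y from ⟨1, by simpa using h⟩)

namespace RotationGraph

open TemperleyDart

variable {n : ℕ} (G : RotationGraph.{u} n)

/-- Exchanges the black and the white end of each edge. -/
def temperleyFlip (X : Type u) : Equiv.Perm (TemperleyDart X) where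
  toFun
    | blackV x => whiteV x
    | whiteV x => blackV x
    | blackF x => whiteF x
    | whiteF x => blackF x
  invFun
    | blackV x => whiteV x
    | whiteV x => blackV x
    | blackF x => whiteF x
    | whiteF x => blackF x
  left_inv := by rintro (x | x | x | x) <;> rfl
  right_inv := by rintro (x | x | x | x) <;> rfl

/-- The counterclockwise rotation around the nodes of the Temperley graph; here `(i, 0)` and `(i, 1)`
are the two boundary nodes that come from the boundary node `i` and from the boundary arc which follows
it. Around the black node of a network node, the order is that of the network. Around the black node
of a face, the order is that of the boundary of the face, traversed counterclockwise. Around the white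
node of the edge of a dart `d`, the order is: tail of `d`, face on the right of `d`, head of `d`, face
on the left of `d`. A boundary node carries one dart and its ray. -/
def temperleyRotAux : Equiv.Perm (TemperleyDart (G.Dart ⊕ Fin n) ⊕ Fin n × Fin 2) where
  toFun
    | Sum.inl (blackV x) => Sum.inl (blackV (G.rot x))
    | Sum.inl (blackF x) => Sum.inl (blackF (G.facePerm.symm x))
    | Sum.inl (whiteV (Sum.inl d)) => Sum.inl (whiteF (Sum.inl d))
    | Sum.inl (whiteF (Sum.inl d)) => Sum.inl (whiteV (Sum.inl (G.flip d)))
    | Sum.inl (whiteV (Sum.inr i)) => Sum.inr (i, 0)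
    | Sum.inl (whiteF (Sum.inr i)) => Sum.inr (i, 1)
    | Sum.inr (i, 0) => Sum.inl (whiteV (Sum.inr i))
    | Sum.inr (i, 1) => Sum.inl (whiteF (Sum.inr i))
  invFun
    | Sum.inl (blackV x) => Sum.inl (blackV (G.rot.symm x))
    | Sum.inl (blackF x) => Sum.inl (blackF (G.facePerm x))
    | Sum.inl (whiteF (Sum.inl d)) => Sum.inl (whiteV (Sum.inl d))
    | Sum.inl (whiteV (Sum.inl d)) => Sum.inl (whiteF (Sum.inl (G.flip d)))
    | Sum.inl (whiteV (Sum.inr i)) => Sum.inr (i, 0)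
    | Sum.inl (whiteF (Sum.inr i)) => Sum.inr (i, 1)
    | Sum.inr (i, 0) => Sum.inl (whiteV (Sum.inr i))
    | Sum.inr (i, 1) => Sum.inl (whiteF (Sum.inr i))
  left_inv := by
    rintro ((x | (d | i) | x | (d | i)) | ⟨i, k⟩)
    all_goals first | (fin_cases k <;> rfl) | simp [G.flip_flip]
  right_inv := by
    rintro ((x | (d | i) | x | (d | i)) | ⟨i, k⟩)
    all_goals first | (fin_cases k <;> rfl) | simp [G.flip_flip]

/-- The rotation of the Temperley graph, with the boundary nodes numbered clockwise: with numbering from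
`0`, the node `(i, k)` has number `2 * i + k`. -/
def temperleyRot : Equiv.Perm (TemperleyDart (G.Dart ⊕ Fin n) ⊕ Fin (n * 2)) :=
  (Equiv.sumCongr (Equiv.refl _) finProdFinEquiv).permCongr G.temperleyRotAux

/-- The embedding of the darts and boundary nodes `(i, k)` into the darts and rays of the Temperley
graph. -/
def temperleyIndex (n : ℕ) (X : Type u) :
    TemperleyDart X ⊕ Fin n × Fin 2 ≃ TemperleyDart X ⊕ Fin (n * 2) :=
  Equiv.sumCongr (Equiv.refl _) finProdFinEquiv

theorem temperleyIndex_symm_inr (X : Type u) (p : Fin n × Fin 2) :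
    (temperleyIndex n X).symm (Sum.inr (finProdFinEquiv p)) = Sum.inr p := by
  rw [Equiv.symm_apply_eq]
  rfl

theorem temperleyRot_index (z : TemperleyDart (G.Dart ⊕ Fin n) ⊕ Fin n × Fin 2) :
    G.temperleyRot (temperleyIndex n _ z) = temperleyIndex n _ (G.temperleyRotAux z) := by
  simp [temperleyRot, temperleyIndex, Equiv.permCongr_apply]

/-- The nodes of the Temperley graph: nodes, faces and edges of the network, and boundary nodes. -/
def temperleyNodeClass : TemperleyDart (G.Dart ⊕ Fin n) ⊕ Fin n × Fin 2 →
    (G.Node ⊕ G.Face) ⊕ (G.Edge ⊕ Fin n × Fin 2)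
  | Sum.inl (blackV x) => Sum.inl (Sum.inl (G.node x))
  | Sum.inl (blackF x) => Sum.inl (Sum.inr (G.face x))
  | Sum.inl (whiteV (Sum.inl d)) => Sum.inr (Sum.inl (G.edge d))
  | Sum.inl (whiteF (Sum.inl d)) => Sum.inr (Sum.inl (G.edge d))
  | Sum.inl (whiteV (Sum.inr i)) => Sum.inr (Sum.inr (i, 0))
  | Sum.inl (whiteF (Sum.inr i)) => Sum.inr (Sum.inr (i, 1))
  | Sum.inr p => Sum.inr (Sum.inr p)

theorem temperleyNodeClass_surjective : Function.Surjective G.temperleyNodeClass := by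
  rintro ((v | v) | (v | p))
  · obtain ⟨x, rfl⟩ := Quotient.exists_rep v
    exact ⟨Sum.inl (blackV x), rfl⟩
  · obtain ⟨x, rfl⟩ := Quotient.exists_rep v
    exact ⟨Sum.inl (blackF x), rfl⟩
  · obtain ⟨d, rfl⟩ := Quotient.exists_rep v
    exact ⟨Sum.inl (whiteV (Sum.inl d)), rfl⟩
  · exact ⟨Sum.inr p, rfl⟩

theorem temperleyNodeClass_rot (z : TemperleyDart (G.Dart ⊕ Fin n) ⊕ Fin n × Fin 2) :
    G.temperleyNodeClass (G.temperleyRotAux z) = G.temperleyNodeClass z := by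
  rcases z with ((x | (d | i) | x | (d | i)) | ⟨i, k⟩)
  · exact congrArg (fun v => Sum.inl (Sum.inl v)) (G.node_eq_of_rot rfl).symm
  · rfl
  · rfl
  · refine congrArg (fun v => Sum.inl (Sum.inr v)) (Quotient.sound ?_)
    exact ⟨1, by simp⟩
  · refine congrArg (fun v => Sum.inr (Sum.inl v)) (Quotient.sound ?_)
    exact (G.sameCycle_flip_iff _ _).2 (Or.inr (G.flip_flip d).symm)
  · rfl
  · fin_cases k <;> rfl

/-- A white dart in the rotation around the white node of an edge or at a boundary node. -/
def temperleyRep : TemperleyDart (G.Dart ⊕ Fin n) ⊕ Fin n × Fin 2 →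
    TemperleyDart (G.Dart ⊕ Fin n) ⊕ Fin n × Fin 2
  | Sum.inl (whiteF (Sum.inl d)) => Sum.inl (whiteV (Sum.inl d))
  | Sum.inl (whiteV (Sum.inr i)) => Sum.inr (i, 0)
  | Sum.inl (whiteF (Sum.inr i)) => Sum.inr (i, 1)
  | z => z

theorem temperleyRep_sameCycle (z : TemperleyDart (G.Dart ⊕ Fin n) ⊕ Fin n × Fin 2) :
    G.temperleyRotAux.SameCycle (G.temperleyRep z) z := by
  rcases z with ((x | (d | i) | x | (d | i)) | p)
  · exact Equiv.Perm.SameCycle.refl _ _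
  · exact Equiv.Perm.SameCycle.refl _ _
  · exact ⟨1, by rfl⟩
  · exact Equiv.Perm.SameCycle.refl _ _
  · exact ⟨1, by rfl⟩
  · exact ⟨1, by rfl⟩
  · exact Equiv.Perm.SameCycle.refl _ _

theorem temperleyRotAux_sameCycle_iff (z z' : TemperleyDart (G.Dart ⊕ Fin n) ⊕ Fin n × Fin 2) :
    G.temperleyRotAux.SameCycle z z' ↔ G.temperleyNodeClass z = G.temperleyNodeClass z' := by
  refine ⟨sameCycle_invariant G.temperleyNodeClass_rot, fun h => ?_⟩
  have hr : ∀ w, G.temperleyNodeClass (G.temperleyRep w) = G.temperleyNodeClass w := fun w =>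
    sameCycle_invariant G.temperleyNodeClass_rot (G.temperleyRep_sameCycle w)
  rw [← hr z, ← hr z'] at h
  refine (G.temperleyRep_sameCycle z).symm.trans (Equiv.Perm.SameCycle.trans ?_
    (G.temperleyRep_sameCycle z'))
  have hV : ∀ x y, G.node x = G.node y →
      G.temperleyRotAux.SameCycle (Sum.inl (blackV x)) (Sum.inl (blackV y)) := fun x y hxy =>
    sameCycle_map (g := fun x => Sum.inl (blackV x)) (fun x => ⟨1, by rfl⟩) (Quotient.exact hxy)
  have hF : ∀ x y, G.face x = G.face y →
      G.temperleyRotAux.SameCycle (Sum.inl (blackF x)) (Sum.inl (blackF y)) := fun x y hxy =>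
    sameCycle_map (g := fun x => Sum.inl (blackF x)) (fun x => Equiv.Perm.SameCycle.symm
      ⟨1, by
        change Sum.inl (blackF (G.facePerm.symm (G.facePerm x))) = _
        rw [Equiv.symm_apply_apply]⟩) (Quotient.exact hxy)
  have hE : ∀ d d', G.edge d = G.edge d' →
      G.temperleyRotAux.SameCycle (Sum.inl (whiteV (Sum.inl d))) (Sum.inl (whiteV (Sum.inl d'))) :=
    fun d d' hdd => sameCycle_map (g := fun d => Sum.inl (whiteV (Sum.inl d)))
      (fun d => ⟨2, by rfl⟩) (Quotient.exact hdd)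
  rcases z with ((x | (d | i) | x | (d | i)) | p) <;>
    rcases z' with ((x' | (d' | i') | x' | (d' | i')) | p') <;>
    simp only [temperleyNodeClass, temperleyRep, Sum.inl.injEq, Sum.inr.injEq, reduceCtorEq] at h ⊢
  all_goals first
    | exact hV _ _ h
    | exact hF _ _ h
    | exact hE _ _ h
    | (rw [h])

theorem temperleyRot_sameCycle_iff (z z' : TemperleyDart (G.Dart ⊕ Fin n) ⊕ Fin (n * 2)) :
    G.temperleyRot.SameCycle z z' ↔
      G.temperleyNodeClass ((temperleyIndex n _).symm z) =
        G.temperleyNodeClass ((temperleyIndex n _).symm z') := by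
  rw [← temperleyRotAux_sameCycle_iff]
  constructor
  · refine sameCycle_map (g := (temperleyIndex n _).symm) fun z => ⟨1, ?_⟩
    obtain ⟨w, rfl⟩ := (temperleyIndex n _).surjective z
    simp [temperleyRot_index]
  · intro h
    have := sameCycle_map (τ := G.temperleyRot) (g := temperleyIndex n _)
      (fun w => ⟨1, by simp [temperleyRot_index]⟩) h
    simpa using this

end RotationGraph

theorem finite_temperleyDart {X : Type u} [Finite X] : Finite (TemperleyDart X) :=
  Finite.of_surjective (fun p : X ⊕ X ⊕ X ⊕ X => match p with
    | Sum.inl x => TemperleyDart.blackV x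
    | Sum.inr (Sum.inl x) => TemperleyDart.whiteV x
    | Sum.inr (Sum.inr (Sum.inl x)) => TemperleyDart.blackF x
    | Sum.inr (Sum.inr (Sum.inr x)) => TemperleyDart.whiteF x) (by
      rintro (x | x | x | x)
      · exact ⟨Sum.inl x, rfl⟩
      · exact ⟨Sum.inr (Sum.inl x), rfl⟩
      · exact ⟨Sum.inr (Sum.inr (Sum.inl x)), rfl⟩
      · exact ⟨Sum.inr (Sum.inr (Sum.inr x)), rfl⟩)

namespace RotationGraph

open TemperleyDart

variable {n : ℕ} (G : RotationGraph.{u} n)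

/-- The graph of the generalized Temperley trick. -/
def temperley : RotationGraph.{u} (n * 2) where
  Dart := TemperleyDart (G.Dart ⊕ Fin n)
  finite_dart := by
    have := G.finite_dart
    exact finite_temperleyDart
  flip := temperleyFlip _
  flip_flip := by rintro (x | x | x | x) <;> rfl
  flip_ne := by rintro (x | x | x | x) <;> simp [temperleyFlip]
  rot := G.temperleyRot
  ray_injective i j h := by
    obtain ⟨p, rfl⟩ := finProdFinEquiv.surjective i
    obtain ⟨q, rfl⟩ := finProdFinEquiv.surjective j
    rw [temperleyRot_sameCycle_iff, temperleyIndex_symm_inr, temperleyIndex_symm_inr] at h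
    simp only [temperleyNodeClass, Sum.inr.injEq] at h
    rw [h]

theorem temperley_node_eq_iff (z z' : TemperleyDart (G.Dart ⊕ Fin n) ⊕ Fin (n * 2)) :
    G.temperley.node z = G.temperley.node z' ↔
      G.temperleyNodeClass ((temperleyIndex n _).symm z) =
        G.temperleyNodeClass ((temperleyIndex n _).symm z') := by
  rw [← temperleyRot_sameCycle_iff]
  exact Quotient.eq (r := Equiv.Perm.SameCycle.setoid G.temperleyRot)

theorem temperley_node_eq_boundaryNode_iff (d : TemperleyDart (G.Dart ⊕ Fin n)) (p : Fin n × Fin 2) :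
    G.temperley.node (Sum.inl d) = G.temperley.boundaryNode (finProdFinEquiv p) ↔
      G.temperleyNodeClass (Sum.inl d) = Sum.inr (Sum.inr p) := by
  refine (G.temperley_node_eq_iff _ _).trans ?_
  have h : G.temperleyNodeClass ((temperleyIndex n (G.Dart ⊕ Fin n)).symm
      (Sum.inr (finProdFinEquiv p))) = Sum.inr (Sum.inr p) :=
    congrArg G.temperleyNodeClass (temperleyIndex_symm_inr _ p)
  exact ⟨fun h1 => h1.trans h, fun h1 => h1.trans h.symm⟩

theorem card_temperley_node : Nat.card G.temperley.Node =
    Nat.card ((G.Node ⊕ G.Face) ⊕ (G.Edge ⊕ Fin n × Fin 2)) :=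
  card_quotient_sameCycle G.temperleyRot
    (fun z => G.temperleyNodeClass ((temperleyIndex n _).symm z))
    (G.temperleyNodeClass_surjective.comp (temperleyIndex n _).symm.surjective)
    G.temperleyRot_sameCycle_iff

theorem card_temperley_edge : Nat.card G.temperley.Edge = 2 * Nat.card (G.Dart ⊕ Fin n) := by
  have h := G.temperley.card_dart
  have := G.finite_dart
  have h2 : Nat.card (TemperleyDart (G.Dart ⊕ Fin n)) = 4 * Nat.card (G.Dart ⊕ Fin n) := by
    rw [Nat.card_congr (β := (G.Dart ⊕ Fin n) × Fin 4) ⟨fun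
      | blackV x => (x, 0)
      | whiteV x => (x, 1)
      | blackF x => (x, 2)
      | whiteF x => (x, 3), fun
      | (x, 0) => blackV x
      | (x, 1) => whiteV x
      | (x, 2) => blackF x
      | (x, 3) => whiteF x, by rintro (x | x | x | x) <;> rfl, by
        rintro ⟨x, k⟩
        fin_cases k <;> rfl⟩]
    rw [Nat.card_prod, Nat.card_eq_fintype_card (α := Fin 4), Fintype.card_fin, mul_comm]
  change Nat.card (TemperleyDart (G.Dart ⊕ Fin n)) = _ at h
  omega

theorem val_finRotate {m : ℕ} (i : Fin m) : (finRotate m i : ℕ) = (i + 1) % m := by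
  have := i.neZero
  rw [finRotate_apply, Fin.val_add, Fin.val_one', Nat.add_mod_mod]

theorem finRotate_index_zero (i : Fin n) :
    finRotate (n * 2) (finProdFinEquiv (i, 0)) = finProdFinEquiv (i, 1) := by
  ext
  have hi := i.2
  rw [val_finRotate]
  simp only [finProdFinEquiv_apply_val, Fin.val_zero, Fin.val_one]
  rw [Nat.mod_eq_of_lt (by omega)]
  omega

theorem finRotate_index_one (i : Fin n) :
    finRotate (n * 2) (finProdFinEquiv (i, 1)) = finProdFinEquiv (finRotate n i, 0) := by
  ext
  have hi := i.2
  rw [val_finRotate]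
  simp only [finProdFinEquiv_apply_val, Fin.val_zero, Fin.val_one]
  rw [val_finRotate]
  by_cases h : (i : ℕ) + 1 = n
  · rw [h, Nat.mod_self, show 1 + 2 * (i : ℕ) + 1 = n * 2 by omega, Nat.mod_self]
  · rw [Nat.mod_eq_of_lt (by omega : (i : ℕ) + 1 < n), Nat.mod_eq_of_lt (by omega)]
    omega

/-- The faces of the Temperley graph correspond to the corners of the network. -/
def temperleyFaceClass : TemperleyDart (G.Dart ⊕ Fin n) ⊕ Fin n × Fin 2 → G.Dart ⊕ Fin n
  | Sum.inl (blackV x) => x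
  | Sum.inl (whiteF x) => x
  | Sum.inl (blackF x) => G.facePerm x
  | Sum.inl (whiteV x) => G.rot x
  | Sum.inr (i, 0) => Sum.inr i
  | Sum.inr (i, 1) => G.facePerm (Sum.inr i)

/-- The face permutation of the Temperley graph, with boundary nodes `(i, k)`. -/
def temperleyFaceAux : TemperleyDart (G.Dart ⊕ Fin n) ⊕ Fin n × Fin 2 →
    TemperleyDart (G.Dart ⊕ Fin n) ⊕ Fin n × Fin 2
  | Sum.inl d => G.temperleyRotAux (Sum.inl (temperleyFlip _ d))
  | Sum.inr (i, 0) => G.temperleyRotAux (Sum.inr (i, 1))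
  | Sum.inr (i, 1) => G.temperleyRotAux (Sum.inr (finRotate n i, 0))

theorem temperley_facePerm_index (z : TemperleyDart (G.Dart ⊕ Fin n) ⊕ Fin n × Fin 2) :
    G.temperley.facePerm (temperleyIndex n _ z) = temperleyIndex n _ (G.temperleyFaceAux z) := by
  rcases z with d | ⟨i, k⟩
  · exact G.temperleyRot_index (Sum.inl (temperleyFlip _ d))
  · fin_cases k
    · change G.temperleyRot (Sum.inr (finRotate (n * 2) (finProdFinEquiv (i, 0)))) = _
      rw [finRotate_index_zero]
      exact G.temperleyRot_index (Sum.inr (i, 1))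
    · change G.temperleyRot (Sum.inr (finRotate (n * 2) (finProdFinEquiv (i, 1)))) = _
      rw [finRotate_index_one]
      exact G.temperleyRot_index (Sum.inr (finRotate n i, 0))

theorem temperleyFaceClass_face (z : TemperleyDart (G.Dart ⊕ Fin n) ⊕ Fin n × Fin 2) :
    G.temperleyFaceClass (G.temperleyFaceAux z) = G.temperleyFaceClass z := by
  rcases z with ((x | x | x | (d | i)) | ⟨i, k⟩)
  · rcases x with d | i <;> rfl
  · rfl
  · rcases x with d | i
    · rfl
    · rfl
  · exact G.facePerm.apply_symm_apply _
  · exact G.facePerm.apply_symm_apply _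
  · fin_cases k <;> rfl

theorem temperleyFace_sameCycle_step (z : TemperleyDart (G.Dart ⊕ Fin n) ⊕ Fin n × Fin 2) :
    G.temperley.facePerm.SameCycle (temperleyIndex n _ z)
      (temperleyIndex n _ (G.temperleyFaceAux z)) :=
  ⟨1, by simpa using G.temperley_facePerm_index z⟩

theorem temperleyFace_sameCycle_rep (z : TemperleyDart (G.Dart ⊕ Fin n) ⊕ Fin n × Fin 2) :
    G.temperley.facePerm.SameCycle (temperleyIndex n _ z)
      (temperleyIndex n _ (Sum.inl (blackV (G.temperleyFaceClass z)))) := by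
  have hwV : ∀ x, G.temperley.facePerm.SameCycle (temperleyIndex n _ (Sum.inl (whiteV x)))
      (temperleyIndex n _ (Sum.inl (blackV (G.rot x)))) := fun x =>
    G.temperleyFace_sameCycle_step (Sum.inl (whiteV x))
  have hodd : ∀ i, G.temperley.facePerm.SameCycle (temperleyIndex n _ (Sum.inr (i, 1)))
      (temperleyIndex n _ (Sum.inl (blackV (G.facePerm (Sum.inr i))))) := fun i =>
    (G.temperleyFace_sameCycle_step (Sum.inr (i, 1))).trans (hwV (Sum.inr (finRotate n i)))
  have hbF : ∀ x, G.temperley.facePerm.SameCycle (temperleyIndex n _ (Sum.inl (blackF x)))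
      (temperleyIndex n _ (Sum.inl (blackV (G.facePerm x)))) := by
    rintro (d | i)
    · exact (G.temperleyFace_sameCycle_step (Sum.inl (blackF (Sum.inl d)))).trans (hwV _)
    · exact (G.temperleyFace_sameCycle_step (Sum.inl (blackF (Sum.inr i)))).trans (hodd i)
  have hwF : ∀ x, G.temperley.facePerm.SameCycle (temperleyIndex n _ (Sum.inl (whiteF x)))
      (temperleyIndex n _ (Sum.inl (blackV x))) := fun x => by
    have h1 := (G.temperleyFace_sameCycle_step (Sum.inl (whiteF x))).trans (hbF (G.facePerm.symm x))
    rwa [Equiv.apply_symm_apply] at h1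
  rcases z with ((x | x | x | x) | ⟨i, k⟩)
  · exact Equiv.Perm.SameCycle.refl _ _
  · exact hwV x
  · exact hbF x
  · exact hwF x
  · fin_cases k
    · exact (G.temperleyFace_sameCycle_step (Sum.inr (i, 0))).trans (hwF (Sum.inr i))
    · exact hodd i

theorem card_temperley_face : Nat.card G.temperley.Face = Nat.card (G.Dart ⊕ Fin n) := by
  refine card_quotient_sameCycle G.temperley.facePerm
    (fun z => G.temperleyFaceClass ((temperleyIndex n _).symm z)) ?_ fun z z' => ⟨?_, fun h => ?_⟩
  · intro x
    exact ⟨temperleyIndex n _ (Sum.inl (blackV x)),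
      congrArg G.temperleyFaceClass ((temperleyIndex n _).symm_apply_apply (Sum.inl (blackV x)))⟩
  · refine sameCycle_invariant
      (f := fun z => G.temperleyFaceClass ((temperleyIndex n _).symm z)) fun z => ?_
    obtain ⟨w, rfl⟩ := (temperleyIndex n _).surjective z
    have h1 := congrArg (fun z => G.temperleyFaceClass ((temperleyIndex n _).symm z))
      (G.temperley_facePerm_index w)
    refine h1.trans ?_
    simp only [Equiv.symm_apply_apply]
    exact G.temperleyFaceClass_face w
  · obtain ⟨w, rfl⟩ := (temperleyIndex n _).surjective z
    obtain ⟨w', rfl⟩ := (temperleyIndex n _).surjective z'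
    rw [Equiv.symm_apply_apply, Equiv.symm_apply_apply] at h
    have h1 := G.temperleyFace_sameCycle_rep w
    rw [h] at h1
    exact h1.trans (G.temperleyFace_sameCycle_rep w').symm

theorem temperley_reachable_flip (d : TemperleyDart (G.Dart ⊕ Fin n)) :
    G.temperley.graph.Reachable (G.temperley.node (Sum.inl d))
      (G.temperley.node (Sum.inl (temperleyFlip _ d))) :=
  G.temperley.reachable_flip d

theorem temperley_reachable_whiteV (x : G.Dart ⊕ Fin n) :
    G.temperley.graph.Reachable (G.temperley.node (Sum.inl (whiteV x)))
      (G.temperley.node (Sum.inl (blackV x))) :=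
  G.temperley_reachable_flip (whiteV x)

theorem temperley_reaches_boundary (h : ∀ v, ∃ i, G.graph.Reachable v (G.boundaryNode i))
    (v : G.temperley.Node) : ∃ i, G.temperley.graph.Reachable v (G.temperley.boundaryNode i) := by
  have hblack : ∀ x y, G.node x = G.node y → G.temperley.node (Sum.inl (blackV x)) =
      G.temperley.node (Sum.inl (blackV y)) := fun x y hxy =>
    (G.temperley_node_eq_iff _ _).2 (congrArg (fun v => Sum.inl (Sum.inl v)) hxy)
  have hedge : ∀ d, G.temperley.graph.Reachable (G.temperley.node (Sum.inl (blackV (Sum.inl d))))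
      (G.temperley.node (Sum.inl (blackV (Sum.inl (G.flip d))))) := fun d => by
    have h1 : G.temperley.node (Sum.inl (whiteV (Sum.inl d))) =
        G.temperley.node (Sum.inl (whiteV (Sum.inl (G.flip d)))) :=
      (G.temperley_node_eq_iff _ _).2 (congrArg (fun v => Sum.inr (Sum.inl v))
        (Quotient.sound ((G.sameCycle_flip_iff _ _).2 (Or.inr rfl))))
    have h2 := G.temperley_reachable_whiteV (Sum.inl (G.flip d))
    rw [← h1] at h2
    exact (G.temperley_reachable_whiteV (Sum.inl d)).symm.trans h2
  have hwalk : ∀ u w, G.graph.Reachable u w → ∀ x y, G.node x = u → G.node y = w →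
      G.temperley.graph.Reachable (G.temperley.node (Sum.inl (blackV x)))
        (G.temperley.node (Sum.inl (blackV y))) := by
    rintro u w ⟨p⟩
    induction p with
    | nil =>
      intro x y hx hy
      rw [hblack x y (hx.trans hy.symm)]
    | cons hadj p ih =>
      intro x y hx hy
      rcases ((SimpleGraph.fromRel_adj _ _ _).1 hadj).2 with ⟨d, hd, hd'⟩ | ⟨d, hd, hd'⟩
      · rw [hblack x _ (hx.trans hd.symm)]
        exact (hedge d).trans (ih _ y hd' hy)
      · rw [hblack x _ (hx.trans hd'.symm)]
        exact (hedge d).symm.trans (ih _ y hd hy)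
  have hB : ∀ x, ∃ i, G.temperley.graph.Reachable (G.temperley.node (Sum.inl (blackV x)))
      (G.temperley.boundaryNode i) := fun x => by
    obtain ⟨i, hi⟩ := h (G.node x)
    refine ⟨finProdFinEquiv (i, 0), (hwalk _ _ hi x (Sum.inr i) rfl rfl).trans ?_⟩
    have h1 : G.temperley.node (Sum.inl (whiteV (Sum.inr i))) =
        G.temperley.boundaryNode (finProdFinEquiv (i, 0)) :=
      (G.temperley_node_eq_boundaryNode_iff _ _).2 rfl
    rw [← h1]
    exact (G.temperley_reachable_whiteV (Sum.inr i)).symm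
  have hV : ∀ x, ∃ i, G.temperley.graph.Reachable (G.temperley.node (Sum.inl (whiteV x)))
      (G.temperley.boundaryNode i) := fun x => by
    obtain ⟨i, hi⟩ := hB x
    exact ⟨i, (G.temperley_reachable_whiteV x).trans hi⟩
  have hF : ∀ x, ∃ i, G.temperley.graph.Reachable (G.temperley.node (Sum.inl (whiteF x)))
      (G.temperley.boundaryNode i) := by
    rintro (d | i)
    · have h1 : G.temperley.node (Sum.inl (whiteF (Sum.inl d))) =
          G.temperley.node (Sum.inl (whiteV (Sum.inl d))) := (G.temperley_node_eq_iff _ _).2 rfl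
      rw [h1]
      exact hV _
    · have h1 : G.temperley.node (Sum.inl (whiteF (Sum.inr i))) =
          G.temperley.boundaryNode (finProdFinEquiv (i, 1)) :=
        (G.temperley_node_eq_boundaryNode_iff _ _).2 rfl
      exact ⟨_, by rw [h1]⟩
  obtain ⟨(x | x | x | x) | j⟩ := v
  · exact hB x
  · exact hV x
  · obtain ⟨i, hi⟩ := hF x
    exact ⟨i, (G.temperley_reachable_flip (blackF x)).trans hi⟩
  · exact hF x
  · exact ⟨j, SimpleGraph.Reachable.refl _⟩

end RotationGraph

/-- The graph of the generalized Temperley trick, as a graph embedded into a disk. -/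
def DiskGraph.temperley {n : ℕ} (G : DiskGraph.{u} n) : DiskGraph.{u} (n * 2) where
  toRotationGraph := G.toRotationGraph.temperley
  reaches_boundary := G.temperley_reaches_boundary G.reaches_boundary
  euler := by
    have := G.finite_dart
    have : Finite G.Node := Quotient.finite _
    have : Finite G.Edge := Quotient.finite _
    have : Finite G.Face := Quotient.finite _
    have h1 := G.euler
    have h2 := G.card_dart
    rw [G.card_temperley_node, G.card_temperley_edge, G.card_temperley_face, Nat.card_sum,
      Nat.card_sum, Nat.card_sum, Nat.card_sum, Nat.card_prod, Nat.card_eq_fintype_card (α := Fin n),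
      Nat.card_eq_fintype_card (α := Fin 2), Fintype.card_fin, Fintype.card_fin, h2]
    push_cast
    linarith

namespace ElectricalNetwork

open TemperleyDart

variable {n : ℕ} (E : ElectricalNetwork.{u} n)

/-- Network nodes and faces are black, the midpoints of the edges and the boundary nodes are white. -/
def temperleyColor : (E.Node ⊕ E.Face) ⊕ (E.Edge ⊕ Fin n × Fin 2) → NodeColor
  | Sum.inl _ => NodeColor.black
  | Sum.inr _ => NodeColor.white

/-- The edges that come from a half of an edge `e` of the network have the conductivity of `e`
as their weight; the other edges have weight `1`. -/
def temperleyWeight : TemperleyDart (E.Dart ⊕ Fin n) → ℝ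
  | blackV (Sum.inl d) => E.conductivity (E.edge d)
  | whiteV (Sum.inl d) => E.conductivity (E.edge d)
  | _ => 1

/-- The Lam model of an electrical network, by the generalized Temperley trick. -/
noncomputable def lamModel : LamModel.{u} (n * 2) where
  toDiskGraph := E.toDiskGraph.temperley
  boundary_degree_one := by
    intro j
    obtain ⟨⟨i, k⟩, rfl⟩ := finProdFinEquiv.surjective j
    have key := fun d => E.temperley_node_eq_boundaryNode_iff d (i, k)
    fin_cases k
    · refine ⟨whiteV (Sum.inr i), (key _).2 rfl, fun d hd => ?_⟩
      have h1 := (key d).1 hd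
      rcases d with x | (x | x) | x | (x | x) <;>
        simp only [RotationGraph.temperleyNodeClass, Sum.inr.injEq, Prod.mk.injEq, reduceCtorEq] at h1
      · exact congrArg (fun y => whiteV (Sum.inr y)) h1.1
      · exact absurd h1.2 (by decide)
    · refine ⟨whiteF (Sum.inr i), (key _).2 rfl, fun d hd => ?_⟩
      have h1 := (key d).1 hd
      rcases d with x | (x | x) | x | (x | x) <;>
        simp only [RotationGraph.temperleyNodeClass, Sum.inr.injEq, Prod.mk.injEq, reduceCtorEq] at h1
      · exact absurd h1.2 (by decide)
      · exact congrArg (fun y => whiteF (Sum.inr y)) h1.1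
  color := Quotient.lift
    (fun z => E.temperleyColor (E.temperleyNodeClass ((RotationGraph.temperleyIndex n _).symm z)))
    fun z z' h => congrArg E.temperleyColor ((E.temperleyRot_sameCycle_iff z z').1 h)
  bipartite := by
    have hbw : NodeColor.black ≠ NodeColor.white := fun h => NodeColor.noConfusion h
    rintro (x | (x | x) | x | (x | x))
    · rcases x with x | x <;> exact hbw
    · exact hbw.symm
    · exact hbw.symm
    · rcases x with x | x <;> exact hbw
    · exact hbw.symm
    · exact hbw.symm
  weight := Quotient.lift E.temperleyWeight fun d d' h => by
    rcases (E.toRotationGraph.temperley.sameCycle_flip_iff d d').1 h with rfl | rfl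
    · rfl
    · rcases d with (x | x) | (x | x) | x | x <;> rfl
  weight_pos := by
    rintro ⟨(x | x) | (x | x) | x | x⟩
    all_goals first
      | exact E.conductivity_pos _
      | exact one_pos

end ElectricalNetwork

/-! Take every median edge of the network in both directions. A direction is determined by the
region on its left, the node or the face at the corner, and the Lam median edge around the black
node of that region runs along it. The median edges around white nodes only link these together. So
each network strand gives two antiparallel Lam strands (`corner_of_straight`,
`strand_blackEdge_corner`), and these never coincide (`not_eqvGen_reverse`).

Self-intersections and lenses: the two lines through a Lam midpoint are directed copies of the two
network strands through an edge midpoint, which are different. The four Lam midpoints around a white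
node realise the four choices of a direction on each of these two strands, one choice each. As two
network strands share at most one edge midpoint, two Lam strands share at most one midpoint
(`lamModel_no_lens`). A lens with a tip at a boundary node is impossible, since only one strand
starts there and only one ends there.

Boundary loops: a strand that starts and ends at the same boundary node has the same region on its
left at both ends. If it passed a midpoint, the strand `t` crossed at the first one would cut the
regions into two sides; the left region would change side there and, since `t` is not met again,
never change back (`eq_of_left_eq`). The two sides exist because the first cohomology of the disk
modulo two vanishes, a dimension count from Euler's formula (`exists_cornerDiff_eq`).

Closed strands: followed backwards, an oriented strand reaches the boundary or is periodic, and a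
periodic one would give a network strand without ends (`exists_start`). -/

/-! ### Linear algebra: orthogonal complements -/

/-- The orthogonal complement of the range of an injective linear map. -/
theorem exists_finrank_add_finrank_eq_card {K X W : Type*} [Field K] [Fintype X] [AddCommGroup W]
    [Module K W] [FiniteDimensional K W] (T : W →ₗ[K] (X → K)) (hT : Function.Injective T) :
    ∃ P : Submodule K (X → K), (∀ g, g ∈ P ↔ ∀ h, ∑ c, T h c * g c = 0) ∧
      Module.finrank K W + Module.finrank K P = Fintype.card X := by
  classical
  let Φ : (X → K) →ₗ[K] Module.Dual K W := T.dualMap ∘ₗ (Module.piEquiv X K K).toLinearMap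
  have hΦ : ∀ g h, Φ g h = ∑ c, T h c * g c := fun g h => by
    simp [Φ, Module.piEquiv_apply_apply]
  have hsurj : Function.Surjective Φ :=
    (LinearMap.dualMap_surjective_of_injective hT).comp (Module.piEquiv X K K).surjective
  refine ⟨LinearMap.ker Φ, fun g => ?_, ?_⟩
  · simp only [LinearMap.mem_ker, LinearMap.ext_iff, hΦ, LinearMap.zero_apply]
  · have h := LinearMap.finrank_range_add_finrank_ker Φ
    rwa [LinearMap.range_eq_top.2 hsurj, finrank_top, Subspace.dual_finrank_eq,
      Module.finrank_fintype_fun_eq_card] at h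

/-! ### Functions on regions, corners and edges modulo two -/

namespace RotationGraph

variable {n : ℕ} (G : RotationGraph.{u} n)

theorem edge_flip (d : G.Dart) : G.edge (G.flip d) = G.edge d :=
  Quotient.sound ((G.sameCycle_flip_iff _ _).2 (Or.inr (G.flip_flip d).symm))

theorem edge_eq_iff (d d' : G.Dart) : G.edge d = G.edge d' ↔ d' = d ∨ d' = G.flip d :=
  (Quotient.eq (r := Equiv.Perm.SameCycle.setoid G.flip)).trans (G.sameCycle_flip_iff d d')

theorem node_rot (x : G.Dart ⊕ Fin n) : G.node (G.rot x) = G.node x :=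
  (G.node_eq_of_rot rfl).symm

theorem face_facePerm (x : G.Dart ⊕ Fin n) : G.face (G.facePerm x) = G.face x :=
  Quotient.sound (Equiv.Perm.SameCycle.symm ⟨1, by simp⟩)

theorem face_rot_inl (d : G.Dart) :
    G.face (G.rot (Sum.inl d)) = G.face (Sum.inl (G.flip d)) := by
  have h := G.face_facePerm (Sum.inl (G.flip d))
  have h2 : G.facePerm (Sum.inl (G.flip d)) = G.rot (Sum.inl d) := by
    change G.rot (Sum.inl (G.flip (G.flip d))) = _
    rw [G.flip_flip]
  rwa [h2] at h

theorem face_rot_inr (i : Fin n) :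
    G.face (G.rot (Sum.inr (finRotate n i))) = G.face (Sum.inr i) :=
  G.face_facePerm (Sum.inr i)

/-- The potential difference across the corners, modulo two: the corner between `c` and `rot c`
separates its node from its face. -/
def cornerDiff : (G.Node ⊕ G.Face → ZMod 2) →ₗ[ZMod 2] (G.Dart ⊕ Fin n → ZMod 2) where
  toFun f c := f (Sum.inl (G.node c)) + f (Sum.inr (G.face (G.rot c)))
  map_add' f g := by
    ext c
    simp only [Pi.add_apply]
    ring
  map_smul' a f := by
    ext c
    simp only [Pi.smul_apply, smul_eq_mul, RingHom.id_apply]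
    ring

/-- The extension by zero to the rays of a function on the edges. -/
def edgeExtend (h : G.Edge → ZMod 2) : G.Dart ⊕ Fin n → ZMod 2 :=
  Sum.elim (fun d => h (G.edge d)) 0

/-- The sum of the values of a function at the two sides of each corner. -/
def edgeBoundary : (G.Edge → ZMod 2) →ₗ[ZMod 2] (G.Dart ⊕ Fin n → ZMod 2) where
  toFun h c := G.edgeExtend h c + G.edgeExtend h (G.rot c)
  map_add' f g := by
    have key : ∀ c, G.edgeExtend (f + g) c = G.edgeExtend f c + G.edgeExtend g c := by
      rintro (d | i) <;> simp [edgeExtend]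
    ext c
    simp only [Pi.add_apply, key]
    ring
  map_smul' a f := by
    have key : ∀ c, G.edgeExtend (a • f) c = a * G.edgeExtend f c := by
      rintro (d | i) <;> simp [edgeExtend]
    ext c
    simp only [Pi.smul_apply, smul_eq_mul, RingHom.id_apply, key]
    ring

/-- Summation by parts around the nodes: the coefficient of each edge is the sum of `g` over the
four corners at its midpoint, which `hg` makes zero. -/
theorem sum_edgeBoundary_mul [Fintype G.Dart] (h : G.Edge → ZMod 2)
    (g : G.Dart ⊕ Fin n → ZMod 2)
    (hg : ∀ d, g (Sum.inl (G.flip d)) + g (G.rot.symm (Sum.inl (G.flip d))) =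
      g (Sum.inl d) + g (G.rot.symm (Sum.inl d))) :
    ∑ c, G.edgeBoundary h c * g c = 0 := by
  have h1 : ∑ c, G.edgeExtend h (G.rot c) * g c = ∑ c, G.edgeExtend h c * g (G.rot.symm c) := by
    rw [← Equiv.sum_comp G.rot (fun c => G.edgeExtend h c * g (G.rot.symm c))]
    simp
  have h2 : ∑ c, G.edgeBoundary h c * g c =
      ∑ c, G.edgeExtend h c * (g c + g (G.rot.symm c)) := by
    simp only [mul_add, Finset.sum_add_distrib, ← h1]
    rw [← Finset.sum_add_distrib]
    exact Finset.sum_congr rfl fun c _ => add_mul _ _ _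
  rw [h2, Fintype.sum_sum_type]
  simp only [edgeExtend, Sum.elim_inl, Sum.elim_inr, Pi.zero_apply, zero_mul,
    Finset.sum_const_zero, add_zero]
  -- By `hg` the two darts of an edge contribute equal terms, which cancel modulo two.
  refine Finset.sum_involution (fun d _ => G.flip d) (fun d _ => ?_) (fun d _ _ => G.flip_ne d)
    (fun _ _ => Finset.mem_univ _) (fun d _ => G.flip_flip d)
  rw [hg, G.edge_flip]
  exact CharTwo.add_self_eq_zero _

theorem eq_of_adj_invariant {α : Type*} {f : G.Node → α}
    (hf : ∀ d, f (G.node (Sum.inl d)) = f (G.node (Sum.inl (G.flip d)))) {u v : G.Node}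
    (h : G.graph.Reachable u v) : f u = f v := by
  obtain ⟨p⟩ := h
  induction p with
  | nil => rfl
  | cons hadj p ih =>
    rcases ((SimpleGraph.fromRel_adj _ _ _).1 hadj).2 with ⟨d, rfl, rfl⟩ | ⟨d, rfl, rfl⟩
    · exact (hf d).trans ih
    · exact (hf d).symm.trans ih

end RotationGraph

/-! ### Vanishing of the first cohomology of the disk -/

namespace DiskGraph

variable {n : ℕ} (G : DiskGraph.{u} n)

/-- A function in the kernel is constant around each node and along each edge, hence on components.
Every component contains a ray, where the extension is zero. -/
theorem edgeBoundary_injective : Function.Injective G.edgeBoundary := by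
  rw [← LinearMap.ker_eq_bot, LinearMap.ker_eq_bot']
  intro h hh
  have hrot : ∀ c, G.edgeExtend h (G.rot c) = G.edgeExtend h c := fun c =>
    (CharTwo.add_eq_zero.1 (congrFun hh c)).symm
  let f : G.Node → ZMod 2 := Quotient.lift (G.edgeExtend h) fun x y hxy =>
    RotationGraph.sameCycle_invariant hrot hxy
  have hf : ∀ v, f v = 0 := fun v => by
    obtain ⟨i, hi⟩ := G.reaches_boundary v
    refine (G.eq_of_adj_invariant (f := f) (fun d => ?_) hi).trans rfl
    exact congrArg h (G.edge_flip d).symm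
  ext e
  obtain ⟨d, rfl⟩ := Quotient.exists_rep e
  exact hf (G.node (Sum.inl d))

/-- Without boundary nodes the graph would be empty, and Euler's formula would read `0 = 1`. -/
theorem pos_of_euler {n : ℕ} (G : DiskGraph.{u} n) : 0 < n := by
  rcases Nat.eq_zero_or_pos n with rfl | h
  · exfalso
    have hN : IsEmpty G.Node := ⟨fun v => (G.reaches_boundary v).elim fun i _ => i.elim0⟩
    have hD : IsEmpty G.Dart := ⟨fun d => hN.elim (G.node (Sum.inl d))⟩
    have hE : IsEmpty G.Edge := ⟨fun e => by
      obtain ⟨d, rfl⟩ := Quotient.exists_rep e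
      exact hD.elim d⟩
    have hF : IsEmpty G.Face := ⟨fun e => by
      obtain ⟨d | i, rfl⟩ := Quotient.exists_rep e
      · exact hD.elim d
      · exact i.elim0⟩
    have := G.euler
    simp at this
  · exact h

/-- A function in the kernel agrees on each node and its incident faces. It passes along edges
through the faces beside them, and between consecutive boundary nodes through the face at the arc;
since all nodes reach the boundary, it is constant. -/
theorem cornerDiff_ker (f : G.Node ⊕ G.Face → ZMod 2) (hf : G.cornerDiff f = 0)
    (a b : G.Node ⊕ G.Face) : f a = f b := by
  have hc : ∀ c, f (Sum.inl (G.node c)) = f (Sum.inr (G.face (G.rot c))) := fun c =>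
    CharTwo.add_eq_zero.1 (congrFun hf c)
  have hc' : ∀ c, f (Sum.inl (G.node c)) = f (Sum.inr (G.face c)) := fun c => by
    have := hc (G.rot.symm c)
    rwa [Equiv.apply_symm_apply, ← G.node_rot, Equiv.apply_symm_apply] at this
  have hd : ∀ d, f (Sum.inl (G.node (Sum.inl d))) = f (Sum.inl (G.node (Sum.inl (G.flip d)))) :=
    fun d => by rw [hc, G.face_rot_inl, hc']
  have hi : ∀ i, f (Sum.inl (G.boundaryNode (finRotate n i))) =
      f (Sum.inl (G.boundaryNode i)) := fun i => by
    change f (Sum.inl (G.node _)) = f (Sum.inl (G.node _))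
    rw [hc, G.face_rot_inr, hc']
  let o : Fin n := ⟨0, G.pos_of_euler⟩
  have hB : ∀ (k : ℕ) (hk : k < n),
      f (Sum.inl (G.boundaryNode ⟨k, hk⟩)) = f (Sum.inl (G.boundaryNode o)) := by
    intro k
    induction k with
    | zero => intro _; rfl
    | succ k ih =>
      intro hk
      rw [← ih (by omega), ← hi ⟨k, by omega⟩]
      congr 3
      ext
      rw [RotationGraph.val_finRotate]
      exact (Nat.mod_eq_of_lt hk).symm
  have hN : ∀ v, f (Sum.inl v) = f (Sum.inl (G.boundaryNode o)) := fun v => by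
    obtain ⟨i, hv⟩ := G.reaches_boundary v
    exact (G.eq_of_adj_invariant (f := fun v => f (Sum.inl v)) hd hv).trans (hB i i.2)
  have hall : ∀ a, f a = f (Sum.inl (G.boundaryNode o)) := by
    rintro (v | F)
    · exact hN v
    · obtain ⟨x, rfl⟩ := Quotient.exists_rep F
      exact (hc' x).symm.trans (hN _)
  rw [hall a, hall b]

/-- The first cohomology modulo two of the disk vanishes: a function on the corners whose sum around
each edge midpoint is zero is a difference of values at nodes and faces. -/
theorem exists_cornerDiff_eq (g : G.Dart ⊕ Fin n → ZMod 2)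
    (hg : ∀ d, g (Sum.inl (G.flip d)) + g (G.rot.symm (Sum.inl (G.flip d))) =
      g (Sum.inl d) + g (G.rot.symm (Sum.inl d))) :
    ∃ f, G.cornerDiff f = g := by
  classical
  have := G.finite_dart
  have : Fintype G.Dart := Fintype.ofFinite _
  have : Finite G.Node := Quotient.finite _
  have : Finite G.Edge := Quotient.finite _
  have : Finite G.Face := Quotient.finite _
  have : Fintype G.Node := Fintype.ofFinite _
  have : Fintype G.Edge := Fintype.ofFinite _
  have : Fintype G.Face := Fintype.ofFinite _
  -- `P` consists of the functions orthogonal to the edge boundaries, and `g` lies in it. Its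
  -- dimension is the number of corners minus the number of edges, that is `#edges + n`.
  obtain ⟨P, hP, h2⟩ := exists_finrank_add_finrank_eq_card G.edgeBoundary G.edgeBoundary_injective
  have hle : LinearMap.range G.cornerDiff ≤ P := by
    rintro _ ⟨f, rfl⟩
    refine (hP _).2 fun h => G.sum_edgeBoundary_mul h _ fun d => ?_
    have key : ∀ c, G.cornerDiff f c + G.cornerDiff f (G.rot.symm c) =
        f (Sum.inr (G.face (G.rot c))) + f (Sum.inr (G.face c)) := fun c => by
      have h1 : G.node (G.rot.symm c) = G.node c := by
        rw [← G.node_rot, Equiv.apply_symm_apply]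
      change f (Sum.inl (G.node c)) + f (Sum.inr (G.face (G.rot c))) +
        (f (Sum.inl (G.node (G.rot.symm c))) + f (Sum.inr (G.face (G.rot (G.rot.symm c))))) = _
      rw [h1, Equiv.apply_symm_apply]
      linear_combination CharTwo.add_self_eq_zero (f (Sum.inl (G.node c)))
    rw [key, key, G.face_rot_inl, G.face_rot_inl, G.flip_flip, add_comm]
  have hker : Module.finrank (ZMod 2) (LinearMap.ker G.cornerDiff) ≤ 1 := by
    have o : G.Node ⊕ G.Face := Sum.inl (G.boundaryNode ⟨0, G.pos_of_euler⟩)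
    refine finrank_le_one (⟨fun _ => 1, ?_⟩ : LinearMap.ker G.cornerDiff) fun f => ⟨f.1 o, ?_⟩
    · exact LinearMap.mem_ker.2 (funext fun c => CharTwo.add_self_eq_zero (1 : ZMod 2))
    · ext a
      simpa using G.cornerDiff_ker f.1 (LinearMap.mem_ker.1 f.2) o a
  have h1 := LinearMap.finrank_range_add_finrank_ker G.cornerDiff
  simp only [Module.finrank_fintype_fun_eq_card, Fintype.card_sum, Fintype.card_fin] at h1 h2
  have h3 := G.euler
  have h4 := G.card_dart
  simp only [Nat.card_eq_fintype_card] at h3 h4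
  -- The range has dimension at least `#nodes + #faces - 1`, which equals `#edges + n` by Euler's
  -- formula.
  have heq : LinearMap.range G.cornerDiff = P :=
    Submodule.eq_of_le_of_finrank_le hle (by omega)
  have hgP : g ∈ P := (hP g).2 fun h => G.sum_edgeBoundary_mul h g hg
  rw [← heq] at hgP
  exact hgP

end DiskGraph

/-! ### Oriented strands of the network -/

theorem eqvGen_of_reflTransGen {α : Type*} {r : α → α → Prop} {x y : α}
    (h : Relation.ReflTransGen r x y) : Relation.EqvGen r x y := by
  induction h with
  | refl => exact .refl _
  | tail _ h ih => exact .trans _ _ _ ih (.rel _ _ h)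

namespace ElectricalNetwork

variable {n : ℕ} (E : ElectricalNetwork.{u} n)

theorem strand_flip (d : E.Dart) :
    E.strand (Sum.inl (E.flip d)) = E.strand (Sum.inl d) :=
  Eq.symm (Quot.sound ⟨d, Or.inl ⟨rfl, rfl⟩⟩)

theorem strand_rot_symm_flip (d : E.Dart) :
    E.strand (E.rot.symm (Sum.inl (E.flip d))) = E.strand (E.rot.symm (Sum.inl d)) :=
  Eq.symm (Quot.sound ⟨d, Or.inr ⟨Equiv.apply_symm_apply _ _, Equiv.apply_symm_apply _ _⟩⟩)

theorem passesThrough_inl (d : E.Dart) : E.PassesThrough (E.strand (Sum.inl d)) (E.edge d) :=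
  ⟨_, d, rfl, rfl, Or.inl rfl⟩

theorem passesThrough_rot_symm (d : E.Dart) :
    E.PassesThrough (E.strand (E.rot.symm (Sum.inl d))) (E.edge d) :=
  ⟨_, d, rfl, rfl, Or.inr (Equiv.apply_symm_apply _ _)⟩

/-- A median edge with an orientation: `(c, true)` runs counterclockwise around the node of the
corner `c`, and `(c, false)` runs clockwise. -/
abbrev DirectedCorner : Type u := E.MedianEdge × Bool

/-- The same median edge in the other direction. -/
def reverse (x : E.DirectedCorner) : E.DirectedCorner := (x.1, !x.2)

/-- The successor relation along oriented strands. -/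
inductive Step : E.DirectedCorner → E.DirectedCorner → Prop
  -- Straight through a midpoint, a strand turns the other way around the next node. So the flag
  -- alternates, and so does the kind of region on the left: node, face, node.
  | pos (d : E.Dart) :
    Step (E.rot.symm (Sum.inl d), true) (E.rot.symm (Sum.inl (E.flip d)), false)
  | neg (d : E.Dart) : Step (Sum.inl d, false) (Sum.inl (E.flip d), true)

variable {E}

theorem Step.reverse {x y : E.DirectedCorner} (h : E.Step x y) :
    E.Step (E.reverse y) (E.reverse x) := by
  cases h with
  | pos d =>
    have := Step.pos (E := E) (E.flip d)
    rwa [E.flip_flip] at this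
  | neg d =>
    have := Step.neg (E := E) (E.flip d)
    rwa [E.flip_flip] at this

theorem reverse_reverse (x : E.DirectedCorner) : E.reverse (E.reverse x) = x := by
  simp [ElectricalNetwork.reverse]

theorem Step.right_unique : Relator.RightUnique E.Step := by
  rintro x y z h h'
  cases h with
  | pos d =>
    generalize hx : (E.rot.symm (Sum.inl d), true) = x at h'
    cases h' with
    | pos d' =>
      have h1 : d = d' := by simpa using hx
      rw [h1]
    | neg d' => simp at hx
  | neg d =>
    generalize hx : ((Sum.inl d, false) : E.DirectedCorner) = x at h'
    cases h' with
    | pos d' => simp at hx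
    | neg d' =>
      have h1 : d = d' := by simpa using hx
      rw [h1]

theorem Step.left_unique : Relator.LeftUnique E.Step := fun x y z h h' => by
  have := Step.right_unique h.reverse h'.reverse
  rw [← reverse_reverse x, this, reverse_reverse]

theorem Step.strand_eq {x y : E.DirectedCorner} (h : E.Step x y) :
    E.strand y.1 = E.strand x.1 := by
  cases h with
  | pos d => exact E.strand_rot_symm_flip d
  | neg d => exact E.strand_flip d

theorem strand_eq_of_reflTransGen {x y : E.DirectedCorner}
    (h : Relation.ReflTransGen E.Step x y) : E.strand y.1 = E.strand x.1 := by
  induction h with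
  | refl => rfl
  | tail _ h ih => exact h.strand_eq.trans ih

theorem strand_eq_of_eqvGen {x y : E.DirectedCorner}
    (h : Relation.EqvGen E.Step x y) : E.strand y.1 = E.strand x.1 := by
  induction h with
  | rel _ _ h => exact h.strand_eq
  | refl => rfl
  | symm _ _ _ ih => exact ih.symm
  | trans _ _ _ _ _ ih ih' => exact ih'.trans ih

/-- Two directed median edges on the same oriented strand follow each other. -/
theorem reflTransGen_or_of_eqvGen {x y : E.DirectedCorner} (h : Relation.EqvGen E.Step x y) :
    Relation.ReflTransGen E.Step x y ∨ Relation.ReflTransGen E.Step y x := by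
  induction h with
  | rel _ _ h => exact Or.inl (.single h)
  | refl => exact Or.inl .refl
  | symm _ _ _ ih => exact ih.symm
  | trans x y z _ _ ih ih' =>
    rcases ih with h | h <;> rcases ih' with h' | h'
    · exact Or.inl (h.trans h')
    · have hs : Relator.RightUnique (Function.swap E.Step) := fun a b c hab hac =>
        Step.left_unique hab hac
      have := Relation.ReflTransGen.total_of_right_unique hs h.swap h'.swap
      rcases this with h1 | h1
      · exact Or.inr h1.swap
      · exact Or.inl h1.swap
    · exact Relation.ReflTransGen.total_of_right_unique Step.right_unique h h'
    · exact Or.inr (h'.trans h)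

theorem reverse_ne (x : E.DirectedCorner) : x ≠ E.reverse x := fun h => by
  have := congrArg Prod.snd h
  simp [ElectricalNetwork.reverse] at this

theorem not_step_reverse (x : E.DirectedCorner) : ¬ E.Step x (E.reverse x) := fun h => by
  generalize hy : E.reverse x = y at h
  cases h with
  | pos d =>
    have h1 := congrArg Prod.fst hy
    exact E.flip_ne d (by simpa [ElectricalNetwork.reverse] using h1.symm)
  | neg d =>
    have h1 := congrArg Prod.fst hy
    exact E.flip_ne d (by simpa [ElectricalNetwork.reverse] using h1.symm)

/-- Reversal maps a path from `x` to its reverse onto a path with the same ends, so by uniqueness of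
steps onto itself. Then the middle of the path is a directed corner equal to its reverse, or a step
from one to its reverse; neither exists. -/
theorem not_reflTransGen_reverse (x : E.DirectedCorner) :
    ¬ Relation.ReflTransGen E.Step x (E.reverse x) := by
  have key : ∀ (k : ℕ) (f : ℕ → E.DirectedCorner) (a b : ℕ), b = a + k →
      (∀ m, a ≤ m → m < b → E.Step (f m) (f (m + 1))) → f b ≠ E.reverse (f a) := by
    intro k
    induction k using Nat.strong_induction_on with
    | _ k ih =>
      intro f a b hb hf h
      rcases k with _ | _ | k
      · subst hb
        exact reverse_ne _ h
      · subst hb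
        have := hf a le_rfl (by omega)
        rw [zero_add] at h
        rw [h] at this
        exact not_step_reverse _ this
      -- Peel off one step at each end: the shorter path again leads from a directed corner to its
      -- reverse.
      · refine ih k (by omega) f (a + 1) (b - 1) (by omega) (fun m h1 h2 => hf m (by omega)
          (by omega)) ?_
        have h1 := (hf a le_rfl (by omega)).reverse
        have h2 := hf (b - 1) (by omega) (by omega)
        rw [Nat.sub_add_cancel (by omega), h] at h2
        exact Step.left_unique h2 h1
  intro h
  have : ∀ y, Relation.ReflTransGen E.Step x y → ∃ (k : ℕ) (f : ℕ → E.DirectedCorner),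
      f 0 = x ∧ f k = y ∧ ∀ m < k, E.Step (f m) (f (m + 1)) := by
    intro y hy
    induction hy with
    | refl => exact ⟨0, fun _ => x, rfl, rfl, fun m hm => absurd hm (Nat.not_lt_zero m)⟩
    | @tail y z _ hyz ih =>
      obtain ⟨k, f, h0, hk, hf⟩ := ih
      refine ⟨k + 1, fun m => if m ≤ k then f m else z, by simpa using h0, by simp, ?_⟩
      intro m hm
      rcases Nat.lt_or_ge m k with h1 | h1
      · simpa [h1.le, Nat.succ_le_of_lt h1] using hf m h1
      · obtain rfl : m = k := by omega
        simpa [hk] using hyz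
  obtain ⟨k, f, h0, hk, hf⟩ := this _ h
  exact key k f 0 k (by omega) (fun m _ hm => hf m hm) (by rw [h0, hk])

/-- An oriented strand does not contain a median edge in both directions. -/
theorem not_eqvGen_reverse (x : E.DirectedCorner) :
    ¬ Relation.EqvGen E.Step x (E.reverse x) := fun h => by
  rcases reflTransGen_or_of_eqvGen h with h | h
  · exact not_reflTransGen_reverse x h
  · have := not_reflTransGen_reverse (E.reverse x)
    rw [reverse_reverse] at this
    exact this h

/-- The corners at `d` and `flip d` follow each other with opposite flags. With equal flags on one
oriented strand, that strand would contain a corner in both directions. -/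
theorem not_eqvGen_flip (d : E.Dart) (b : Bool) :
    ¬ Relation.EqvGen E.Step (Sum.inl d, b) (Sum.inl (E.flip d), b) := fun h => by
  cases b with
  | true =>
    exact not_eqvGen_reverse (Sum.inl d, false) (.symm _ _
      (.trans _ _ _ h (.symm _ _ (.rel _ _ (Step.neg d)))))
  | false =>
    exact not_eqvGen_reverse (Sum.inl (E.flip d), false)
      (.trans _ _ _ (.symm _ _ h) (.rel _ _ (Step.neg d)))

theorem not_eqvGen_rot_symm_flip (d : E.Dart) (b : Bool) : ¬ Relation.EqvGen E.Step
    (E.rot.symm (Sum.inl d), b) (E.rot.symm (Sum.inl (E.flip d)), b) := fun h => by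
  cases b with
  | true =>
    exact not_eqvGen_reverse (E.rot.symm (Sum.inl (E.flip d)), true)
      (.trans _ _ _ (.symm _ _ h) (.rel _ _ (Step.pos d)))
  | false =>
    exact not_eqvGen_reverse (E.rot.symm (Sum.inl d), true)
      (.trans _ _ _ (.rel _ _ (Step.pos d)) (.symm _ _ h))

/-! ### Starting points of oriented strands -/

/-- Otherwise the finite set of directed corners preceding `x` is closed under predecessors. The
predecessor map on it is injective, hence bijective, so the set is closed under successors too. It
then covers the whole network strand, including a corner at the boundary, where a step is missing.
-/
theorem IsMinimal.exists_start (hmin : E.IsMinimal) (x : E.DirectedCorner) :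
    ∃ y, Relation.ReflTransGen E.Step y x ∧ ∀ z, ¬ E.Step z y := by
  by_contra! hcon
  have := E.finite_dart
  let S := {y // Relation.ReflTransGen E.Step y x}
  have : Finite S := Subtype.finite
  choose p hp using fun y : S => hcon y.1 y.2
  let q : S → S := fun y => ⟨p y, .head (hp y) y.2⟩
  have hq : Function.Injective q := fun y z hyz => by
    have h1 : p y = p z := congrArg Subtype.val hyz
    have h2 := hp y
    rw [h1] at h2
    exact Subtype.ext (Step.right_unique h2 (hp z))
  have hS : ∀ y, Relation.ReflTransGen E.Step y x →
      ∃ z, E.Step y z ∧ Relation.ReflTransGen E.Step z x := fun y hy => by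
    obtain ⟨z, hz⟩ := Finite.injective_iff_surjective.1 hq ⟨y, hy⟩
    have h1 : p z = y := congrArg Subtype.val hz
    exact ⟨z.1, h1 ▸ hp z, z.2⟩
  let I : Set E.MedianEdge := {c | ∃ b, Relation.ReflTransGen E.Step (c, b) x}
  have hstep : ∀ y z, E.Step y z → (y.1 ∈ I → z.1 ∈ I) := by
    rintro y z h ⟨b, hb⟩
    by_cases hyb : y.2 = b
    · obtain rfl : b = y.2 := hyb.symm
      obtain ⟨w, hw, hwx⟩ := hS y hb
      rw [Step.right_unique hw h] at hwx
      exact ⟨z.2, hwx⟩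
    -- If the set contains `y` in the other direction, the reversed step is a predecessor step.
    · have h1 : (y.1, b) = E.reverse y := by
        rw [ElectricalNetwork.reverse]
        cases b <;> simp_all
      rw [h1] at hb
      exact ⟨_, .head h.reverse hb⟩
  have hopp : ∀ c c', E.Opposite c c' → (c ∈ I ↔ c' ∈ I) := by
    rintro c c' ⟨d, ⟨rfl, rfl⟩ | ⟨h, h'⟩⟩
    · exact ⟨hstep _ _ (Step.neg d), hstep _ _ (Step.neg d).reverse⟩
    · rw [← Equiv.eq_symm_apply] at h h'
      subst h h'
      exact ⟨hstep _ _ (Step.pos d), hstep _ _ (Step.pos d).reverse⟩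
  have hI : ∀ c c', E.strand c = E.strand c' → (c ∈ I ↔ c' ∈ I) := fun c c' h => by
    have := Quot.eqvGen_exact h
    clear h
    induction this with
    | rel _ _ h => exact hopp _ _ h
    | refl => rfl
    | symm _ _ _ ih => exact ih.symm
    | trans _ _ _ _ _ ih ih' => exact ih.trans ih'
  obtain ⟨c, i, hc, hci⟩ := hmin.no_closed_strand (E.strand x.1)
  obtain ⟨b, hb⟩ := (hI c x.1 hc).2 ⟨x.2, .refl⟩
  obtain ⟨z, hz, -⟩ := hS _ hb
  obtain ⟨w, hw⟩ := hcon _ hb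
  -- At an end on the boundary, one direction has no predecessor, against `hw`, and the other has no
  -- successor, against `hz`.
  rcases hci with rfl | hci
  · cases b with
    | true =>
      generalize hy : ((Sum.inr i, true) : E.DirectedCorner) = y at hw
      cases hw <;> simp at hy
    | false =>
      generalize hy : ((Sum.inr i, false) : E.DirectedCorner) = y at hz
      cases hz <;> simp at hy
  · rw [← Equiv.eq_symm_apply] at hci
    subst hci
    cases b with
    | true =>
      generalize hy : ((E.rot.symm (Sum.inr i), true) : E.DirectedCorner) = y at hz
      cases hz <;> simp at hy
    | false =>
      generalize hy : ((E.rot.symm (Sum.inr i), false) : E.DirectedCorner) = y at hw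
      cases hw <;> simp at hy

/-- A directed corner begins at one of its two sides. If this side is a dart, there is a step into
it from across the midpoint, so it has to be a ray. -/
theorem start_cases {y : E.DirectedCorner} (h : ∀ z, ¬ E.Step z y) :
    ∃ i : Fin n, y = (Sum.inr i, true) ∨ y = (E.rot.symm (Sum.inr i), false) := by
  obtain ⟨c, b⟩ := y
  cases b with
  | true =>
    rcases c with d | i
    · have := Step.neg (E := E) (E.flip d)
      rw [E.flip_flip] at this
      exact absurd this (h _)
    · exact ⟨i, Or.inl rfl⟩
  | false =>
    obtain ⟨c, rfl⟩ := E.rot.symm.surjective c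
    rcases c with d | i
    · have := Step.pos (E := E) (E.flip d)
      rw [E.flip_flip] at this
      exact absurd this (h _)
    · exact ⟨i, Or.inr rfl⟩

/-! ### Regions beside a strand and crossings -/

/-- The region on the left of a directed median edge. -/
def left : E.DirectedCorner → E.Node ⊕ E.Face
  | (c, true) => Sum.inl (E.node c)
  | (c, false) => Sum.inr (E.face (E.rot c))

/-- The directed median edge `x` ends at the midpoint of the edge of the dart `d`, on the side of its
tail. -/
def EndsAt (x : E.DirectedCorner) (d : E.Dart) : Prop :=
  x = (E.rot.symm (Sum.inl d), true) ∨ x = (Sum.inl d, false)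

theorem EndsAt.passesThrough {x : E.DirectedCorner} {d : E.Dart} (h : EndsAt x d) :
    E.PassesThrough (E.strand x.1) (E.edge d) := by
  rcases h with rfl | rfl
  · exact E.passesThrough_rot_symm d
  · exact E.passesThrough_inl d

/-- Only one of the two lines through the midpoint belongs to the strand. So a second passage
follows the same line, either in the same direction or backwards. -/
theorem IsMinimal.eq_or_step_reverse (hmin : E.IsMinimal) {x x' : E.DirectedCorner}
    {d d' : E.Dart} (h : EndsAt x d) (h' : EndsAt x' d') (he : E.edge d' = E.edge d)
    (hs : E.strand x'.1 = E.strand x.1) : x' = x ∨ E.Step x (E.reverse x') := by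
  rcases (E.edge_eq_iff _ _).1 he.symm with rfl | rfl
  · left
    rcases h with rfl | rfl <;> rcases h' with rfl | rfl
    · rfl
    · exact absurd hs (hmin.no_self_intersection _)
    · exact absurd hs.symm (hmin.no_self_intersection _)
    · rfl
  · right
    rcases h with rfl | rfl <;> rcases h' with rfl | rfl
    · exact Step.pos d
    · exact absurd ((E.strand_flip d).symm.trans hs) (hmin.no_self_intersection _)
    · exact absurd (hs.symm.trans (E.strand_rot_symm_flip d)) (hmin.no_self_intersection _)
    · exact Step.neg d

/-- Where a strand passes an edge midpoint, it crosses another strand, and the region on its left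
changes across a median edge of that strand. -/
theorem IsMinimal.exists_crossing (hmin : E.IsMinimal) {x y : E.DirectedCorner}
    (h : E.Step x y) : ∃ (c : E.MedianEdge) (d : E.Dart), EndsAt x d ∧
      E.strand c ≠ E.strand x.1 ∧ E.PassesThrough (E.strand c) (E.edge d) ∧
      ∀ f, f (left x) + f (left y) = E.cornerDiff f c := by
  cases h with
  | pos d =>
    -- The corner on the other side of `d` at its tail: it lies on the crossing line, between the
    -- node on the left before the midpoint and the face on the left after it.
    refine ⟨Sum.inl d, d, Or.inl rfl, hmin.no_self_intersection d, E.passesThrough_inl d,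
      fun f => ?_⟩
    change f (Sum.inl (E.node _)) + f (Sum.inr (E.face (E.rot (E.rot.symm _)))) =
      f (Sum.inl (E.node _)) + f (Sum.inr (E.face (E.rot _)))
    rw [Equiv.apply_symm_apply, E.face_rot_inl, ← E.node_rot (E.rot.symm _),
      Equiv.apply_symm_apply]
  | neg d =>
    refine ⟨E.rot.symm (Sum.inl (E.flip d)), d, Or.inr rfl, ?_, ?_, fun f => ?_⟩
    · rw [E.strand_rot_symm_flip]
      exact (hmin.no_self_intersection d).symm
    · rw [E.strand_rot_symm_flip]
      exact E.passesThrough_rot_symm d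
    · change f (Sum.inr (E.face (E.rot _))) + f (Sum.inl (E.node _)) =
        f (Sum.inl (E.node _)) + f (Sum.inr (E.face (E.rot (E.rot.symm _))))
      rw [Equiv.apply_symm_apply, E.face_rot_inl, ← E.node_rot (E.rot.symm _),
        Equiv.apply_symm_apply, add_comm]

open Classical in
/-- The two sides of a strand. -/
theorem exists_side (t : E.Strand) : ∃ f : E.Node ⊕ E.Face → ZMod 2,
    ∀ c, E.cornerDiff f c = if E.strand c = t then 1 else 0 := by
  -- Opposite corners at a midpoint lie on the same strand, so the indicator of `t` sums to zero
  -- around every midpoint.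
  obtain ⟨f, hf⟩ := E.exists_cornerDiff_eq (fun c => if E.strand c = t then 1 else 0) fun d => by
    simp only [E.strand_flip, E.strand_rot_symm_flip]
  exact ⟨f, congrFun hf⟩

/-- In a minimal network, a strand with the same region on the left of its first and last median
edge has only one median edge. -/
theorem IsMinimal.eq_of_left_eq (hmin : E.IsMinimal) {x y : E.DirectedCorner}
    (hx : ∀ z, ¬ E.Step z x) (h : Relation.ReflTransGen E.Step x y) (hl : left x = left y) :
    x = y := by
  classical
  rcases h.cases_head with h | ⟨x₁, h1, h'⟩
  · exact h
  exfalso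
  obtain ⟨c, d, hd, hc, hcd, hf⟩ := hmin.exists_crossing h1
  obtain ⟨f, hfc⟩ := exists_side (E.strand c)
  -- After the first midpoint the left region stays on one side of the crossed strand. A second
  -- crossing would take place on the same edge, by `no_lens`.
  have key : f (left x₁) = f (left y) := by
    clear hl h
    induction h' with
    | refl => rfl
    | @tail z w hz hzw ih =>
      refine ih.trans ?_
      obtain ⟨c', d', hd', hc', hcd', hf'⟩ := hmin.exists_crossing hzw
      have hs := strand_eq_of_reflTransGen (Relation.ReflTransGen.head h1 hz)
      have hne : E.strand c' ≠ E.strand c := fun hcc => by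
        have he : E.edge d' = E.edge d := hmin.no_lens (E.strand x.1) (E.strand c) _ _ hc.symm
          (hs ▸ hd'.passesThrough) (hcc ▸ hcd') hd.passesThrough hcd
        -- A second passage in the same direction would give the start `x` a predecessor. A passage
        -- backwards would put `z` and its reverse on one oriented strand.
        rcases hmin.eq_or_step_reverse hd hd' he hs with rfl | h3
        · rcases hz.cases_tail with rfl | ⟨w', -, hw'⟩
          · exact hx _ h1
          · exact hx _ hw'
        · refine not_eqvGen_reverse z (.trans _ _ _ (.symm _ _ ?_) (.rel _ _ h3))
          exact eqvGen_of_reflTransGen (.head h1 hz)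
      have h3 := hf' f
      rw [hfc, if_neg hne] at h3
      exact CharTwo.add_eq_zero.1 h3
  have h2 := hf f
  rw [key, hl, CharTwo.add_self_eq_zero, hfc, if_pos rfl] at h2
  exact zero_ne_one h2

end ElectricalNetwork

/-! ### Strands of a general Lam model -/

namespace LamModel

variable {n : ℕ} (L : LamModel.{u} n)

theorem node_turn (d : L.Dart) : L.node (L.turn d) = L.node (Sum.inl d) := by
  unfold turn
  split
  · exact L.node_rot _
  · rw [← L.node_rot, Equiv.apply_symm_apply]

theorem turn_injective : Function.Injective L.turn := fun d d' h => by
  have hn : L.node (Sum.inl d) = L.node (Sum.inl d') := by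
    rw [← L.node_turn d, h, L.node_turn d']
  unfold turn at h
  rw [hn] at h
  split at h <;> simpa using h

theorem liesOn_boundary_unique {d d' : L.Dart} {j : Fin n} (h : L.LiesOn d (Sum.inl j))
    (h' : L.LiesOn d' (Sum.inl j)) : d = d' :=
  L.flip.injective ((L.boundary_degree_one j).unique h h')

theorem eq_of_liesOn_boundary {d : L.Dart} {j : Fin n} {p : L.MedianNode}
    (h : L.LiesOn d (Sum.inl j)) (hp : L.LiesOn d p) : p = Sum.inl j := by
  rcases p with i | e
  · have h1 : L.boundaryNode j = L.boundaryNode i := h.symm.trans hp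
    exact congrArg Sum.inl (L.ray_injective i j (Quotient.exact h1.symm))
  · exact absurd h (e.2 (L.flip d) ((L.edge_flip d).trans hp) j)

theorem leaves_boundary_unique {a b : L.MedianEdge} {j : Fin n} (h : L.Leaves a (Sum.inl j))
    (h' : L.Leaves b (Sum.inl j)) : a = b :=
  Subtype.ext (L.liesOn_boundary_unique h h')

theorem enters_boundary_unique {a b : L.MedianEdge} {j : Fin n} (h : L.Enters a (Sum.inl j))
    (h' : L.Enters b (Sum.inl j)) : a = b := by
  obtain ⟨d, hd, hj⟩ := h
  obtain ⟨d', hd', hj'⟩ := h'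
  obtain rfl := L.liesOn_boundary_unique hj hj'
  exact Subtype.ext (L.turn_injective (hd.trans hd'.symm))

/-- Lets an end of a lens at a midpoint be treated like its beginning, through median edges that
leave. -/
theorem exists_leaves_of_enters {b : L.MedianEdge} {e : L.InnerEdge}
    (h : L.Enters b (Sum.inr e)) : ∃ c, L.strand c = L.strand b ∧ L.Leaves c (Sum.inr e) := by
  obtain ⟨d, hd, he⟩ := h
  have h1 : L.edge (L.flip d) = e.1 := (L.edge_flip d).trans he
  exact ⟨⟨L.flip d, e.2 _ h1⟩, (Quot.sound ⟨d, hd, rfl⟩ : L.strand b = _).symm, h1⟩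

theorem strand_eq_of_reflTransGen {a b : L.MedianEdge} (h : Relation.ReflTransGen L.Straight a b) :
    L.strand b = L.strand a := by
  induction h with
  | refl => rfl
  | tail _ h ih => exact (Quot.sound h : L.strand _ = L.strand _).symm.trans ih

theorem eq_or_eq_flip_of_leaves {a b : L.MedianEdge} {e : L.InnerEdge}
    (ha : L.Leaves a (Sum.inr e)) (hb : L.Leaves b (Sum.inr e)) : b.1 = a.1 ∨ b.1 = L.flip a.1 :=
  (L.edge_eq_iff _ _).1 ((show L.edge a.1 = e.1 from ha).trans (show L.edge b.1 = e.1 from hb).symm)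

/-- A median edge that leaves and enters the same boundary node isolates it. -/
theorem isIsolated_of_loop {a : L.MedianEdge} {j : Fin n} (h : L.Leaves a (Sum.inl j))
    (h' : L.Enters a (Sum.inl j)) : L.IsIsolated j := by
  rintro b p (⟨hb, d, hd, hp⟩ | ⟨hp, hb⟩)
  · obtain rfl := L.leaves_boundary_unique h hb
    obtain ⟨d', hd', hj⟩ := h'
    obtain rfl := Sum.inl_injective (hd.symm.trans hd')
    exact L.eq_of_liesOn_boundary hj hp
  · obtain rfl := L.enters_boundary_unique h' hb
    exact L.eq_of_liesOn_boundary h hp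

end LamModel

/-! ### Lam strands as oriented network strands -/

namespace ElectricalNetwork

open TemperleyDart

variable {n : ℕ} (E : ElectricalNetwork.{u} n)

theorem lamModel_isInner (d : TemperleyDart (E.Dart ⊕ Fin n))
    (h : ∀ p, E.temperleyNodeClass (Sum.inl d) ≠ Sum.inr (Sum.inr p)) :
    E.lamModel.IsInner (E.lamModel.node (Sum.inl d)) := fun j hj => by
  obtain ⟨p, rfl⟩ := finProdFinEquiv.surjective j
  exact h p ((E.temperley_node_eq_boundaryNode_iff d p).1 hj)

theorem not_lamModel_isInner_whiteV (i : Fin n) :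
    ¬ E.lamModel.IsInner (E.lamModel.node (Sum.inl (whiteV (Sum.inr i)))) := fun h =>
  h _ ((E.temperley_node_eq_boundaryNode_iff (whiteV (Sum.inr i)) (i, 0)).2 rfl)

theorem not_lamModel_isInner_whiteF (i : Fin n) :
    ¬ E.lamModel.IsInner (E.lamModel.node (Sum.inl (whiteF (Sum.inr i)))) := fun h =>
  h _ ((E.temperley_node_eq_boundaryNode_iff (whiteF (Sum.inr i)) (i, 1)).2 rfl)

/-- The directed corner of the network that a median edge of the Lam model runs along, or leads to if it
belongs to a white node. -/
def corner : TemperleyDart (E.Dart ⊕ Fin n) → E.DirectedCorner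
  | blackV x => (x, true)
  | blackF x => (E.rot.symm x, false)
  | whiteV (Sum.inl d) => (E.rot.symm (Sum.inl (E.flip d)), false)
  -- An unused value, as is that of `whiteF (Sum.inr i)`: these darts start at boundary nodes and
  -- carry no median edge.
  | whiteV (Sum.inr i) => (Sum.inr i, true)
  | whiteF x => (x, true)

/-- The median edge of the Lam model at a black node that runs along a directed corner. -/
def blackEdge : E.DirectedCorner → E.lamModel.MedianEdge
  | (c, true) => ⟨blackV c, E.lamModel_isInner _ fun _ h => by cases h⟩
  | (c, false) => ⟨blackF (E.rot c), E.lamModel_isInner _ fun _ h => by cases h⟩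

theorem facePerm_inl_flip (d : E.Dart) : E.facePerm (Sum.inl (E.flip d)) = E.rot (Sum.inl d) := by
  change E.rot (Sum.inl (E.flip (E.flip d))) = _
  rw [E.flip_flip]

/-- Going from a black node to a white one passes a network midpoint, which is a step. Going from
white to black reaches the corner already assigned to the white median edge. -/
theorem corner_of_straight {a b : E.lamModel.MedianEdge} (h : E.lamModel.Straight a b) :
    E.corner a.1 = E.corner b.1 ∨ E.Step (E.corner a.1) (E.corner b.1) := by
  obtain ⟨a, ha⟩ := a
  obtain ⟨b, hb⟩ := b
  obtain ⟨d, hd, hbd⟩ := h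
  change b = _ at hbd
  subst hbd
  rcases a with x | (x | i) | x | (x | i)
  · obtain ⟨x, rfl⟩ := E.rot.symm.surjective x
    obtain rfl : blackV x = d := Sum.inl_injective ((congrArg (fun y => Sum.inl (blackV y))
      (E.rot.apply_symm_apply x)).symm.trans hd)
    rcases x with x | i
    · exact Or.inr (Step.pos x)
    · exact absurd hb (E.not_lamModel_isInner_whiteV i)
  · obtain rfl : whiteF (Sum.inl (E.flip x)) = d := Sum.inl_injective hd
    exact Or.inl rfl
  · exact absurd ha (E.not_lamModel_isInner_whiteV i)
  · obtain ⟨x, rfl⟩ := E.facePerm.surjective x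
    obtain rfl : blackF x = d := Sum.inl_injective ((congrArg (fun y => Sum.inl (blackF y))
      (E.facePerm.symm_apply_apply x)).symm.trans hd)
    rcases x with x | i
    · right
      change E.Step (E.rot.symm (E.rot (Sum.inl (E.flip x))), false) (Sum.inl x, true)
      have := Step.neg (E := E) (E.flip x)
      rwa [Equiv.symm_apply_apply, E.flip_flip] at *
    · exact absurd hb (E.not_lamModel_isInner_whiteF i)
  · obtain rfl : whiteV (Sum.inl x) = d := Sum.inl_injective hd
    exact Or.inl rfl
  · exact absurd ha (E.not_lamModel_isInner_whiteF i)

theorem eqvGen_corner {a b : E.lamModel.MedianEdge} (h : E.lamModel.strand a = E.lamModel.strand b) :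
    Relation.EqvGen E.Step (E.corner a.1) (E.corner b.1) := by
  have h1 := Quot.eqvGen_exact h
  clear h
  induction h1 with
  | rel a b h =>
    rcases E.corner_of_straight h with h | h
    · rw [h]
      exact .refl _
    · exact .rel _ _ h
  | refl => exact .refl _
  | symm _ _ _ ih => exact .symm _ _ ih
  | trans _ _ _ _ _ ih ih' => exact .trans _ _ _ ih ih'

/-- Every median edge at a white node is continued straight by one at a black node, so black
representatives suffice. -/
theorem strand_blackEdge_corner (a : E.lamModel.MedianEdge) :
    E.lamModel.strand (E.blackEdge (E.corner a.1)) = E.lamModel.strand a := by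
  obtain ⟨a, ha⟩ := a
  rcases a with x | (x | i) | x | (x | i)
  · rfl
  · refine (Quot.sound ⟨whiteF (Sum.inl (E.flip x)), rfl, ?_⟩ : E.lamModel.strand _ = _).symm
    exact congrArg blackF (E.rot.apply_symm_apply _)
  · exact absurd ha (E.not_lamModel_isInner_whiteV i)
  · refine congrArg _ (Subtype.ext ?_)
    exact congrArg blackF (E.rot.apply_symm_apply _)
  · exact (Quot.sound ⟨whiteV (Sum.inl x), rfl, rfl⟩ : E.lamModel.strand _ = _).symm
  · exact absurd ha (E.not_lamModel_isInner_whiteF i)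

/-- The black median edges of two consecutive corners are linked by one median edge around a white
node. -/
theorem strand_blackEdge_of_step {x y : E.DirectedCorner} (h : E.Step x y) :
    E.lamModel.strand (E.blackEdge x) = E.lamModel.strand (E.blackEdge y) := by
  cases h with
  | pos d =>
    have hw := E.lamModel_isInner (whiteV (Sum.inl d)) fun _ h => by cases h
    refine Eq.trans (Quot.sound ⟨blackV (Sum.inl d), ?_, rfl⟩)
      (E.strand_blackEdge_corner ⟨whiteV (Sum.inl d), hw⟩).symm
    exact congrArg (fun y => Sum.inl (blackV y)) (E.rot.apply_symm_apply _)
  | neg d =>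
    have hw := E.lamModel_isInner (whiteF (Sum.inl (E.flip d))) fun _ h => by cases h
    refine Eq.trans (Quot.sound ⟨blackF (Sum.inl (E.flip d)), ?_, rfl⟩)
      (E.strand_blackEdge_corner ⟨whiteF (Sum.inl (E.flip d)), hw⟩).symm
    exact congrArg (fun y => Sum.inl (blackF y))
      ((Equiv.symm_apply_eq _).2 (E.facePerm_inl_flip d).symm)

theorem leaves_blackEdge_true (i : Fin n) :
    E.lamModel.Leaves (E.blackEdge (Sum.inr i, true)) (Sum.inl (finProdFinEquiv (i, 0))) :=
  (E.temperley_node_eq_boundaryNode_iff (whiteV (Sum.inr i)) (i, 0)).2 rfl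

theorem leaves_blackEdge_false (i : Fin n) : E.lamModel.Leaves
    (E.blackEdge (E.rot.symm (Sum.inr i), false)) (Sum.inl (finProdFinEquiv (i, 1))) := by
  have h : E.blackEdge (E.rot.symm (Sum.inr i), false) =
      ⟨blackF (Sum.inr i), E.lamModel_isInner _ fun _ h => by cases h⟩ := by
    refine Subtype.ext ?_
    exact congrArg blackF (E.rot.apply_symm_apply _)
  rw [h]
  exact (E.temperley_node_eq_boundaryNode_iff (whiteF (Sum.inr i)) (i, 1)).2 rfl

theorem enters_blackEdge_true (i : Fin n) : E.lamModel.Enters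
    (E.blackEdge (E.rot.symm (Sum.inr i), true)) (Sum.inl (finProdFinEquiv (i, 0))) := by
  refine ⟨blackV (Sum.inr i), ?_,
    (E.temperley_node_eq_boundaryNode_iff (whiteV (Sum.inr i)) (i, 0)).2 rfl⟩
  exact congrArg (fun y => Sum.inl (blackV y)) (E.rot.apply_symm_apply _)

theorem enters_blackEdge_false (i : Fin n) : E.lamModel.Enters
    -- Counterclockwise around its face, the last corner before the arc from `i` to the next
    -- boundary node is at that next node, hence `finRotate`.
    (E.blackEdge (Sum.inr (finRotate n i), false)) (Sum.inl (finProdFinEquiv (i, 1))) := by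
  refine ⟨blackF (Sum.inr i), ?_,
    (E.temperley_node_eq_boundaryNode_iff (whiteF (Sum.inr i)) (i, 1)).2 rfl⟩
  exact congrArg (fun y => Sum.inl (blackF y)) (E.facePerm.symm_apply_apply (Sum.inr i))

variable {E}

theorem corner_blackEdge (x : E.DirectedCorner) : E.corner (E.blackEdge x).1 = x := by
  obtain ⟨c, b⟩ := x
  cases b with
  | true => rfl
  | false =>
    change (E.rot.symm (E.rot c), false) = _
    rw [Equiv.symm_apply_apply]

theorem not_step_inr (i : Fin n) (z : E.DirectedCorner) : ¬ E.Step z (Sum.inr i, true) := fun h => by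
  generalize hy : ((Sum.inr i, true) : E.DirectedCorner) = y at h
  cases h <;> simp at hy

theorem not_step_rot_symm_inr (i : Fin n) (z : E.DirectedCorner) :
    ¬ E.Step z (E.rot.symm (Sum.inr i), false) := fun h => by
  generalize hy : ((E.rot.symm (Sum.inr i), false) : E.DirectedCorner) = y at h
  cases h <;> simp at hy

/-! ### Minimality of the Lam model -/

/-- The two median edges that leave a midpoint. -/
theorem leaves_inner_cases {a b : E.lamModel.MedianEdge} {e : E.lamModel.InnerEdge}
    (ha : E.lamModel.Leaves a (Sum.inr e)) (hb : E.lamModel.Leaves b (Sum.inr e)) (hne : a ≠ b) :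
    ∃ d, (a.1 = blackV (Sum.inl d) ∧ b.1 = whiteV (Sum.inl d)) ∨
      (a.1 = whiteV (Sum.inl d) ∧ b.1 = blackV (Sum.inl d)) ∨
      (a.1 = blackF (Sum.inl d) ∧ b.1 = whiteF (Sum.inl d)) ∨
      (a.1 = whiteF (Sum.inl d) ∧ b.1 = blackF (Sum.inl d)) := by
  obtain ⟨a, ha'⟩ := a
  obtain ⟨b, hb'⟩ := b
  rcases E.lamModel.eq_or_eq_flip_of_leaves ha hb with h | h
  · exact absurd (Subtype.ext h.symm) hne
  change b = _ at h
  subst h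
  rcases a with (x | i) | (x | i) | (x | i) | (x | i)
  · exact ⟨x, Or.inl ⟨rfl, rfl⟩⟩
  · exact absurd hb' (E.not_lamModel_isInner_whiteV i)
  · exact ⟨x, Or.inr (Or.inl ⟨rfl, rfl⟩)⟩
  · exact absurd ha' (E.not_lamModel_isInner_whiteV i)
  · exact ⟨x, Or.inr (Or.inr (Or.inl ⟨rfl, rfl⟩))⟩
  · exact absurd hb' (E.not_lamModel_isInner_whiteF i)
  · exact ⟨x, Or.inr (Or.inr (Or.inr ⟨rfl, rfl⟩))⟩
  · exact absurd ha' (E.not_lamModel_isInner_whiteF i)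

/-- The two median edges leaving a Lam midpoint lie over the two lines through one network midpoint,
which belong to different strands. -/
theorem IsMinimal.strand_ne_of_leaves (hmin : E.IsMinimal) {a b : E.lamModel.MedianEdge}
    {e : E.lamModel.InnerEdge} (ha : E.lamModel.Leaves a (Sum.inr e))
    (hb : E.lamModel.Leaves b (Sum.inr e)) (hne : a ≠ b) :
    E.strand (E.corner a.1).1 ≠ E.strand (E.corner b.1).1 := by
  obtain ⟨d, h⟩ := leaves_inner_cases ha hb hne
  have := hmin.no_self_intersection d
  rcases h with ⟨h, h'⟩ | ⟨h, h'⟩ | ⟨h, h'⟩ | ⟨h, h'⟩ <;> rw [h, h'] <;>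
    simp only [corner, E.strand_rot_symm_flip]
  · exact this
  · exact this.symm
  · exact this.symm
  · exact this

/-- Both Lam midpoints lie over the same network edge by `no_lens`. Around its white node, distinct
midpoints differ in the direction of at least one of the two strands, and an oriented strand does
not contain its own reverse. -/
theorem IsMinimal.lamModel_no_lens (hmin : E.IsMinimal) {a a' c c' : E.lamModel.MedianEdge}
    {e f : E.lamModel.InnerEdge} (ha : E.lamModel.Leaves a (Sum.inr e))
    (ha' : E.lamModel.Leaves a' (Sum.inr e)) (hc : E.lamModel.Leaves c (Sum.inr f))
    (hc' : E.lamModel.Leaves c' (Sum.inr f)) (h : E.lamModel.strand a = E.lamModel.strand c)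
    (h' : E.lamModel.strand a' = E.lamModel.strand c')
    (hne : E.lamModel.strand a ≠ E.lamModel.strand a') : e = f := by
  have hac : a ≠ a' := fun h => hne (congrArg _ h)
  have hcc : c ≠ c' := fun hcc => hne (h.trans ((congrArg _ hcc).trans h'.symm))
  have hs := hmin.strand_ne_of_leaves ha ha' hac
  have h1 := E.eqvGen_corner h
  have h1' := E.eqvGen_corner h'
  have h2 := strand_eq_of_eqvGen h1
  have h2' := strand_eq_of_eqvGen h1'
  have key : ∀ {a b : E.lamModel.MedianEdge} {d : E.Dart},
      (a.1 = blackV (Sum.inl d) ∧ b.1 = whiteV (Sum.inl d)) ∨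
      (a.1 = whiteV (Sum.inl d) ∧ b.1 = blackV (Sum.inl d)) ∨
      (a.1 = blackF (Sum.inl d) ∧ b.1 = whiteF (Sum.inl d)) ∨
      (a.1 = whiteF (Sum.inl d) ∧ b.1 = blackF (Sum.inl d)) →
      E.PassesThrough (E.strand (E.corner a.1).1) (E.edge d) ∧
      E.PassesThrough (E.strand (E.corner b.1).1) (E.edge d) := by
    intro a b d h
    have h1 := E.passesThrough_inl d
    have h2 := E.passesThrough_rot_symm d
    rcases h with ⟨h, h'⟩ | ⟨h, h'⟩ | ⟨h, h'⟩ | ⟨h, h'⟩ <;> rw [h, h'] <;>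
      simp only [corner, E.strand_rot_symm_flip]
    · exact ⟨h1, h2⟩
    · exact ⟨h2, h1⟩
    · exact ⟨h2, h1⟩
    · exact ⟨h1, h2⟩
  obtain ⟨d, hd⟩ := leaves_inner_cases ha ha' hac
  obtain ⟨g, hg⟩ := leaves_inner_cases hc hc' hcc
  have he := hmin.no_lens _ _ _ _ hs (key hd).1 (key hd).2 (h2 ▸ (key hg).1) (h2' ▸ (key hg).2)
  -- For each of the two lines through the midpoint: its two directions belong to different oriented
  -- strands.
  have hF := not_eqvGen_flip d true
  have hR := not_eqvGen_rot_symm_flip d false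
  have hR' := fun h => hR (.symm _ _ h)
  have hsame : a.1 = c.1 ∨ a.1 = c'.1 → e = f := fun h => by
    refine Subtype.ext ((show E.lamModel.edge a.1 = e.1 from ha).symm.trans ?_)
    rcases h with h | h <;> rw [h]
    · exact hc
    · exact hc'
  have hns := hmin.no_self_intersection d
  -- In each combination of positions at the white node, the midpoints agree, one oriented strand
  -- would run in both directions, or the two lines would lie on one network strand.
  rcases (E.edge_eq_iff _ _).1 he with rfl | rfl <;>
  rcases hd with ⟨h3, h3'⟩ | ⟨h3, h3'⟩ | ⟨h3, h3'⟩ | ⟨h3, h3'⟩ <;>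
  rcases hg with ⟨h4, h4'⟩ | ⟨h4, h4'⟩ | ⟨h4, h4'⟩ | ⟨h4, h4'⟩ <;>
  rw [h3, h4] at h1 h2 hsame <;> rw [h3', h4'] at h1' h2' <;>
  simp only [corner, E.flip_flip, E.strand_rot_symm_flip, E.strand_flip] at h1 h1' h2 h2' <;>
  first
    | exact hsame (Or.inl rfl)
    | exact absurd h1 hF
    | exact absurd h1' hF
    | exact absurd h1 hR
    | exact absurd h1' hR
    | exact absurd h1 hR'
    | exact absurd h1' hR'
    | exact absurd h2 hns
    | exact absurd h2' hns

/-- At a boundary node of the Lam model, the starting and the ending corner have the same region on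
their left: the network node for an odd one, the face at the arc for an even one. So `eq_of_left_eq`
applies. -/
theorem IsMinimal.lamModel_no_boundary_loop (hmin : E.IsMinimal) {a b : E.lamModel.MedianEdge}
    {j : Fin (n * 2)} (h : E.lamModel.strand a = E.lamModel.strand b)
    (ha : E.lamModel.Leaves a (Sum.inl j)) (hb : E.lamModel.Enters b (Sum.inl j)) : a = b := by
  have key : ∀ x y : E.DirectedCorner, a = E.blackEdge x → b = E.blackEdge y →
      (∀ z, ¬ E.Step z x) → left x = left y → a = b := by
    rintro x y rfl rfl hx hl
    have h1 := E.eqvGen_corner h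
    rw [corner_blackEdge, corner_blackEdge] at h1
    rcases reflTransGen_or_of_eqvGen h1 with h2 | h2
    · rw [hmin.eq_of_left_eq hx h2 hl]
    -- The corner `x` has no predecessor, so a path into it is trivial.
    · rcases h2.cases_tail with rfl | ⟨z, -, hz⟩
      · rfl
      · exact absurd hz (hx z)
  obtain ⟨⟨i, k⟩, rfl⟩ := finProdFinEquiv.surjective j
  fin_cases k
  · refine key _ _ (E.lamModel.leaves_boundary_unique ha (E.leaves_blackEdge_true i))
      (E.lamModel.enters_boundary_unique hb (E.enters_blackEdge_true i)) (not_step_inr i) ?_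
    refine congrArg Sum.inl ?_
    rw [← E.node_rot (E.rot.symm _), Equiv.apply_symm_apply]
  · refine key _ _ (E.lamModel.leaves_boundary_unique ha (E.leaves_blackEdge_false i))
      (E.lamModel.enters_boundary_unique hb (E.enters_blackEdge_false i))
      (not_step_rot_symm_inr i) ?_
    refine congrArg Sum.inr ?_
    rw [Equiv.apply_symm_apply, E.face_rot_inr]

theorem IsMinimal.lamModel_no_closed_strand (hmin : E.IsMinimal) (s : E.lamModel.Strand) :
    ∃ (a : E.lamModel.MedianEdge) (j : Fin (n * 2)),
      E.lamModel.strand a = s ∧ E.lamModel.Leaves a (Sum.inl j) := by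
  obtain ⟨a, rfl⟩ := Quot.exists_rep s
  obtain ⟨y, hy, hstart⟩ := hmin.exists_start (E.corner a.1)
  have hs : E.lamModel.strand (E.blackEdge y) = E.lamModel.strand a := by
    rw [← E.strand_blackEdge_corner a]
    clear hstart
    generalize E.corner a.1 = x at hy ⊢
    induction hy with
    | refl => rfl
    | tail _ h ih => exact ih.trans (E.strand_blackEdge_of_step h)
  obtain ⟨i, rfl | rfl⟩ := start_cases hstart
  · exact ⟨_, _, hs, E.leaves_blackEdge_true i⟩
  · exact ⟨_, _, hs, E.leaves_blackEdge_false i⟩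

end ElectricalNetwork

/-- The Lam model that the generalized Temperley trick makes of a minimal connected electrical network
is minimal. -/
theorem mainTheorem6 {n : ℕ} (E : ElectricalNetwork.{u} n) (hmin : E.IsMinimal)
    (hconn : E.Connected) : E.lamModel.IsMinimal := by
  refine ⟨fun a b e ha hb h => ?_, hmin.lamModel_no_closed_strand, fun a b j h ha hb => ?_, ?_⟩
  · by_contra hne
    exact hmin.strand_ne_of_leaves ha hb hne
      (ElectricalNetwork.strand_eq_of_eqvGen (E.eqvGen_corner h)).symm
  · obtain rfl := hmin.lamModel_no_boundary_loop h ha hb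
    exact E.lamModel.isIsolated_of_loop ha hb
  · rintro _ _ p q hst hpq ⟨⟨a, b, rfl, ha, hab, hb⟩, ⟨a', b', rfl, ha', hab', hb'⟩⟩
    have h1 := E.lamModel.strand_eq_of_reflTransGen hab
    have h1' := E.lamModel.strand_eq_of_reflTransGen hab'
    rcases p with i | e
    -- A boundary node has degree one, so only one median edge leaves it and only one enters it; a
    -- tip there makes the strands equal.
    · exact hst (congrArg _ (E.lamModel.leaves_boundary_unique ha ha'))
    rcases q with j | f
    · rw [← h1, ← h1', E.lamModel.enters_boundary_unique hb hb'] at hst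
      exact hst rfl
    obtain ⟨c, hc, hcf⟩ := E.lamModel.exists_leaves_of_enters hb
    obtain ⟨c', hc', hcf'⟩ := E.lamModel.exists_leaves_of_enters hb'
    exact hpq (congrArg Sum.inr (hmin.lamModel_no_lens ha ha' hcf hcf' (hc.trans h1).symm
      (hc'.trans h1').symm hst))
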